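/- All graphs are finite and loopless; parallel edges are allowed unless a graph is called simple. $N(v)$ denotes the set of neighbours of a vertex $v$. A graph is *3-connected* if it has more than $3$ vertices and deleting any two vertices leaves a connected graph. *BG-operations.* A BG-operation turns a 3-connected graph $H$ into a graph $H'$ in one of the following ways: (a) add an edge $xy$ between two distinct vertices $x,y$ of $H$ (possibly parallel to an existing edge); (b) subdivide an edge $ab$ by a new vertex $x$ and add the edge $xy$ for a vertex $y \notin \{a,b\}$ of $H$; (c) subdivide two distinct non-parallel edges by new vertices $x$ and $y$, respectively, and add the edge $xy$. In each case $xy$ is the edge *added* by the operation. The operation is *basic* if it creates no parallel edges. A (basic) construction sequence from $K_4$ to $G$ is a finite, possibly empty, sequence of (basic) BG-operations that turns a copy of $K_4$ into $G$. *Removals.* *Smoothing* a vertex $v$ with $\deg(v)=2$, $|N(v)|=2$ and $v\notin N(v)$ means deleting $v$ and adding an edge between its two neighbours; smoothing any other vertex changes nothing. *Removing* an edge $e=xy$ means deleting $e$ and then smoothing $x$ and $y$. The edge $e$ is *removable* if removing it yields a 3-connected graph. Call the removal of $e=xy$ from a graph *good* if $e$ is removable and, in the graph before the removal, $|N(x)|\ge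 3$, $|N(y)|\ge 3$ and $|N(x)\cup N(y)|\ge 5$. **Theorem.** (1) For a simple graph $G$ the following are equivalent: (i) $G$ is 3-connected; (ii) there is a finite (possibly empty) sequence of good removals that turns $G$ into a copy of $K_4$; (iii) there is a construction sequence from $K_4$ to $G$ using BG-operations; (iv) there is a basic construction sequence from $K_4$ to $G$ using BG-operations. (2) Good removals are exactly the inverses of the BG-operations whose resulting graph has at least five vertices: for graphs $H, H'$ and an edge label $e$, the graph $H$ arises from $H'$ by the good removal of $e$ if and only if $H'$ has at least five vertices and arises from $H$ by a BG-operation that adds $e$. In particular, whenever $H'$ arises from $H$ by a basic BG-operation that adds $e$, the graph $H$ arises from $H'$ by the good removal of $e$. -/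

import Mathlib

open scoped Graph

namespace Graph

variable {α β : Type*}

/-- The graph obtained from `G` by adding an edge with label `f` between `x` and `y`. It is only
used for a label `f` that is not the label of an edge of `G`. -/
def addEdge (G : Graph α β) (f : β) (x y : α) : Graph α β where
  vertexSet := insert x (insert y V(G))
  IsLink g u v := (g = f ∧ (u = x ∧ v = y ∨ u = y ∧ v = x)) ∨ (g ≠ f ∧ G.IsLink g u v)
  isLink_symm g _ := ⟨fun u v h => by
    rcases h with ⟨h, h'⟩ | ⟨h, h'⟩
    · exact Or.inl ⟨h, by tauto⟩
    · exact Or.inr ⟨h, h'.symm⟩⟩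
  eq_or_eq_of_isLink_of_isLink g u v w z h h' := by
    rcases h with ⟨h1, h2⟩ | ⟨h1, h2⟩ <;> rcases h' with ⟨h3, h4⟩ | ⟨h3, h4⟩
    · grind
    · exact absurd h1 h3
    · exact absurd h3 h1
    · exact h2.left_eq_or_eq h4
  left_mem_of_isLink g u v h := by
    rcases h with ⟨_, h⟩ | ⟨_, h⟩
    · grind
    · exact Set.mem_insert_of_mem _ (Set.mem_insert_of_mem _ h.left_mem)

/-- The set `N(v)` of neighbours of `v`. -/
def nbrs (G : Graph α β) (v : α) : Set α := {w | G.Adj v w}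

/-- The degree of `v`: the number of edges at `v`, loops counted twice. -/
noncomputable def deg (G : Graph α β) (v : α) : ℕ∞ :=
  (G.incidenceSet v).encard + (G.loopSet v).encard

/-- Any two vertices are joined by a path. -/
def IsConnected (G : Graph α β) : Prop :=
  ∀ u ∈ V(G), ∀ v ∈ V(G), Relation.ReflTransGen G.Adj u v

/-- `G` is `k`-connected (for `k ≥ 1`): it has more than `k` vertices, and deleting any `k - 1`
vertices leaves a connected graph. -/
def IsKConnected (G : Graph α β) (k : ℕ) : Prop :=
  (k : ℕ∞) < V(G).encard ∧
    ∀ X ⊆ V(G), X.encard + 1 = k → (G.deleteVerts X).IsConnected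

/-- `G` is (a copy of) the complete graph on four vertices. -/
def IsK4 (G : Graph α β) : Prop :=
  G.Simple ∧ V(G).encard = 4 ∧ ∀ x ∈ V(G), ∀ y ∈ V(G), x ≠ y → G.Adj x y

/-- Two edges are parallel if they have the same ends. -/
def Parallel (G : Graph α β) (e f : β) : Prop :=
  ∃ a b, G.IsLink e a b ∧ G.IsLink f a b

/-- The vertices that smoothing affects: `deg(v) = 2`, `|N(v)| = 2` and `v ∉ N(v)`. -/
def IsSmoothable (G : Graph α β) (v : α) : Prop :=
  G.deg v = 2 ∧ (G.nbrs v).encard = 2 ∧ v ∉ G.nbrs v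

/-- `H` arises from `G` by smoothing `v`: if `v` is smoothable, it is deleted and an edge between
its two neighbours is added (under any label that is then free); otherwise nothing changes. -/
def IsSmoothing (G : Graph α β) (v : α) (H : Graph α β) : Prop :=
  (G.IsSmoothable v ∧ ∃ (a b : α) (f : β), G.nbrs v = {a, b} ∧ f ∉ E(G.deleteVerts {v}) ∧
      H = (G.deleteVerts {v}).addEdge f a b) ∨
    (¬ G.IsSmoothable v ∧ H = G)

/-- `H` arises from `G` by removing the edge `e = xy`: deleting `e`, then smoothing its two
ends, `x` before `y`. -/
def IsRemoval (G : Graph α β) (e : β) (x y : α) (H : Graph α β) : Prop :=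
  G.IsLink e x y ∧ ∃ K, (G.deleteEdges {e}).IsSmoothing x K ∧ K.IsSmoothing y H

/-- `H` arises from `G` by removing a removable edge `e = xy` (so `H` is 3-connected) with
`|N(x)| ≥ 3`, `|N(y)| ≥ 3` and `|N(x) ∪ N(y)| ≥ 5`. -/
def IsGoodRemoval (G : Graph α β) (e : β) (H : Graph α β) : Prop :=
  ∃ x y, G.IsRemoval e x y H ∧ H.IsKConnected 3 ∧
    3 ≤ (G.nbrs x).encard ∧ 3 ≤ (G.nbrs y).encard ∧ 5 ≤ (G.nbrs x ∪ G.nbrs y).encard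

/-- `K` arises from `G` by subdividing the edge `e = ab` by a new vertex `x`: the edge `e` is
replaced by edges `ax` and `xb`, whose labels are distinct and are not labels of other edges. -/
def IsSubdividing (G : Graph α β) (e : β) (x : α) (K : Graph α β) : Prop :=
  ∃ (a b : α) (e₁ e₂ : β), G.IsLink e a b ∧ x ∉ V(G) ∧ e₁ ≠ e₂ ∧
    e₁ ∉ E(G.deleteEdges {e}) ∧ e₂ ∉ E(G.deleteEdges {e}) ∧
    K = ((G.deleteEdges {e}).addEdge e₁ a x).addEdge e₂ x b

/-- `G.IsBGOp g H`: the graph `H` arises from the 3-connected graph `G` by one of the three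
operations of Barnette and Grünbaum, and `g` is the edge `xy` that is added by it. -/
inductive IsBGOp (G : Graph α β) (g : β) : Graph α β → Prop
  | add (x y : α) (h3 : G.IsKConnected 3) (hx : x ∈ V(G)) (hy : y ∈ V(G)) (hxy : x ≠ y)
      (hg : g ∉ E(G)) : IsBGOp G g (G.addEdge g x y)
  | subdivideOne (e : β) (x y : α) (K : Graph α β) (h3 : G.IsKConnected 3)
      (hK : G.IsSubdividing e x K) (hy : y ∈ V(G)) (hye : ¬ G.Inc e y)
      (hg : g ∉ E(K)) : IsBGOp G g (K.addEdge g x y)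
  | subdivideTwo (e f : β) (x y : α) (K L : Graph α β) (h3 : G.IsKConnected 3)
      (he : e ∈ E(G)) (hf : f ∈ E(G)) (hef : e ≠ f) (hpar : ¬ G.Parallel e f)
      (hK : G.IsSubdividing e x K) (hL : K.IsSubdividing f y L)
      (hg : g ∉ E(L)) : IsBGOp G g (L.addEdge g x y)

/-- A basic operation: it creates no parallel edges, that is, any two distinct parallel edges of
the new graph are edges of the old graph with the same ends. -/
def IsBasicBGOp (G : Graph α β) (g : β) (H : Graph α β) : Prop :=
  G.IsBGOp g H ∧
    ∀ e f a b, e ≠ f → H.IsLink e a b → H.IsLink f a b → G.IsLink e a b ∧ G.IsLink f a b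

end Graph

/-! Three facts carry both parts. First, good removals undo BG-operations (`isGoodRemoval_iff`).
Smoothing is inverse to subdividing, and the neighbourhood conditions ensure that the added edge
joins a subdividing vertex to no end of its own subdivided edge, and that two subdivided edges are
not parallel. Second, BG-operations preserve 3-connectivity (`IsBGOp.isKConnected`): deleting two
vertices of the new graph amounts to deleting at most two vertices or edges of the old one, since
deleting a subdividing vertex only costs the subdivided edge. Third, a simple 3-connected graph with
at least five vertices arises by a BG-operation from a simple 3-connected graph with fewer edges
(`IsKConnected.exists_isBGOp`). Induction on the number of edges gives (i) → (iv), as an operation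
with simple result is basic; the first fact gives (iv) → (ii) → (iii), the second (iii) → (i).

The third fact is the main work (`IsThreeLinked.exists_not_isObstructed`). An edge `xy` is bad only
if, after deleting it, two vertices `u`, `v` separate `A ∋ x` from `B ∋ y` with a second vertex on
each side (a fat separation), or if an end has degree three and its other two neighbours are
adjacent, so that smoothing would create a parallel edge. Suppose every edge is bad. A triangle of
the second kind yields a fat separation (`IsThreeLinked.isFatSep_of_isTri`), so fat separations
exist. Take one with `|A|` minimal and a neighbour `w` of `x` in `A`. If `xw` had a fat separation,
uncrossing it with the first (`IsFatSep.adj_of_isFatSep`) would leave `x` no neighbours but `w`, `y`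
and one of `u`, `v`; minimality then forces `A = {x, w}`, which is impossible
(`IsFatSep.false_of_pair`). So `w` has degree three and lies on a triangle with its neighbours other
than `x`. The fat separation at `w` that this triangle yields leads to one for `xw`, to the case `A
= {x, w}`, or to a cut of size two. -/

namespace Graph

/-! ### Adding edges, neighbourhoods and small cardinalities. -/

section Basic

variable {α β : Type*} {G H K : Graph α β} {a b c d p q u v w x y z : α} {e f g : β}

@[simp, grind =]
lemma vertexSet_addEdge : V(G.addEdge f x y) = insert x (insert y V(G)) := rfl

@[simp, grind =]
lemma addEdge_isLink : (G.addEdge f x y).IsLink g u v ↔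
    (g = f ∧ (u = x ∧ v = y ∨ u = y ∧ v = x)) ∨ (g ≠ f ∧ G.IsLink g u v) := Iff.rfl

lemma mem_edgeSet_iff : e ∈ E(G) ↔ ∃ u v, G.IsLink e u v := G.edge_mem_iff_exists_isLink e

lemma mem_edgeSet_addEdge : e ∈ E(G.addEdge f x y) ↔ e = f ∨ e ∈ E(G) := by
  simp only [mem_edgeSet_iff, addEdge_isLink]
  grind

lemma addEdge_comm : G.addEdge f x y = G.addEdge f y x := by
  ext <;> simp <;> grind

lemma addEdge_adj_of_notMem (hf : f ∉ E(G)) :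
    (G.addEdge f x y).Adj u v ↔ G.Adj u v ∨ (u = x ∧ v = y ∨ u = y ∧ v = x) := by
  simp only [Adj, addEdge_isLink]
  constructor
  · grind
  · rintro (⟨e, he⟩ | h)
    · exact ⟨e, Or.inr ⟨fun h => hf (h ▸ he.edge_mem), he⟩⟩
    · exact ⟨f, Or.inl ⟨rfl, h⟩⟩

lemma Loopless.addEdge (hG : G.Loopless) (hxy : x ≠ y) : (G.addEdge f x y).Loopless := by
  rw [loopless_iff_forall_ne_of_adj]
  rintro u v ⟨e, he⟩
  rw [addEdge_isLink] at he
  rcases he with he | he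
  · grind
  · exact he.2.ne

lemma Simple.addEdge (hG : G.Simple) (hxy : x ≠ y) (h : ¬ G.Adj x y) : (G.addEdge f x y).Simple where
  not_isLoopAt := (Loopless.addEdge hG.toLoopless hxy).not_isLoopAt
  eq_of_isLink e g u v he hg := by
    rw [addEdge_isLink] at he hg
    rcases he with he | he <;> rcases hg with hg | hg
    · grind
    · exfalso; apply h
      rcases he.2 with ⟨rfl, rfl⟩ | ⟨rfl, rfl⟩
      · exact hg.2.adj
      · exact hg.2.symm.adj
    · exfalso; apply h
      rcases hg.2 with ⟨rfl, rfl⟩ | ⟨rfl, rfl⟩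
      · exact he.2.adj
      · exact he.2.symm.adj
    · exact he.2.eq hg.2

lemma deleteEdges_addEdge (he : e ∉ E(G)) (hx : x ∈ V(G)) (hy : y ∈ V(G)) :
    (G.addEdge e x y).deleteEdges {e} = G := by
  ext
  · simp; grind
  · simp; grind [IsLink.edge_mem]

lemma addEdge_deleteEdges (h : G.IsLink e x y) : (G.deleteEdges {e}).addEdge e x y = G := by
  ext
  · simp; grind
  · have := @IsLink.eq_and_eq_or_eq_and_eq _ _ x y e G
    simp; grind [IsLink.symm]

lemma notMem_edgeSet_deleteEdges : e ∉ E(G.deleteEdges {e}) := by simp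

@[simp]
lemma mem_nbrs : w ∈ G.nbrs v ↔ G.Adj v w := Iff.rfl

lemma encard_pair_le_two {γ : Type*} (p q : γ) : ({p, q} : Set γ).encard ≤ 2 := by
  refine (Set.encard_insert_le _ _).trans ?_
  rw [Set.encard_singleton]
  norm_num

lemma three_le_encard {γ : Type*} {s : Set γ} {a b c : γ} (ha : a ∈ s) (hb : b ∈ s) (hc : c ∈ s)
    (hab : a ≠ b) (hac : a ≠ c) (hbc : b ≠ c) : 3 ≤ s.encard := by
  have : ({a, b, c} : Set γ) ⊆ s := by grind
  rw [← Set.encard_eq_three.2 ⟨a, b, c, hab, hac, hbc, rfl⟩]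
  exact Set.encard_le_encard this

lemma succ_le_encard_of_notMem {γ : Type*} {s t : Set γ} {a : γ} {n : ℕ∞} (hs : n ≤ s.encard)
    (hst : s ⊆ t) (ha : a ∉ s) (hat : a ∈ t) : n + 1 ≤ t.encard := by
  have : insert a s ⊆ t := Set.insert_subset hat hst
  calc n + 1 ≤ s.encard + 1 := by gcongr
    _ = (insert a s).encard := (Set.encard_insert_of_notMem ha).symm
    _ ≤ _ := Set.encard_le_encard this

lemma exists_ne_ne_of_three_le {γ : Type*} {s : Set γ} (hs : 3 ≤ s.encard) (p q : γ) :
    ∃ z ∈ s, z ≠ p ∧ z ≠ q := by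
  by_contra! h
  have : s ⊆ {p, q} := by grind
  have h2 := (Set.encard_le_encard this).trans (encard_pair_le_two p q)
  have := hs.trans h2
  norm_num at this

end Basic

/-! ### 3-connectivity in terms of edges that leave a vertex set. -/

section Connectivity

variable {α β : Type*} {G H K : Graph α β} {a b c d p q u v w x y z : α} {e f g : β}

/-- Any set of vertices that is neither empty nor everything after deleting `p` and `q`
is left by an edge avoiding `p` and `q`. -/
lemma isKConnected_three_of_crossing (hV : 3 < V(G).encard)
    (h : ∀ (Q : Set α) (p q a z : α), p ∈ V(G) → q ∈ V(G) → p ≠ q → a ∈ V(G) → z ∈ V(G) →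
      a ∈ Q → a ≠ p → a ≠ q → z ∉ Q → z ≠ p → z ≠ q →
      ∃ c d, G.Adj c d ∧ c ∈ Q ∧ c ≠ p ∧ c ≠ q ∧ d ∉ Q ∧ d ≠ p ∧ d ≠ q) :
    G.IsKConnected 3 := by
  refine ⟨by exact_mod_cast hV, fun X hX hX2 u hu v hv => ?_⟩
  have hX2 : X.encard = 2 := by
    have : X.encard + 1 = 2 + 1 := by rw [hX2]; norm_num
    exact ENat.add_left_injective_of_ne_top ENat.one_ne_top this
  obtain ⟨p, q, hpq, rfl⟩ := Set.encard_eq_two.1 hX2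
  by_contra hcon
  simp only [vertexSet_deleteVerts, Set.mem_sdiff, Set.mem_insert_iff, Set.mem_singleton_iff,
    not_or] at hu hv
  obtain ⟨c, d, ⟨e, hcd⟩, hc, hcp, hcq, hd, hdp, hdq⟩ :=
    h {w | Relation.ReflTransGen (G.deleteVerts {p, q}).Adj u w} p q u v (hX (by simp))
    (hX (by simp)) hpq hu.1 hv.1 Relation.ReflTransGen.refl hu.2.1 hu.2.2 hcon hv.2.1 hv.2.2
  exact hd (Relation.ReflTransGen.tail hc ⟨e, by simp [*]⟩)

lemma IsKConnected.crossing_of_ne (hG : G.IsKConnected 3) (Q : Set α) (hp : p ∈ V(G))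
    (hq : q ∈ V(G)) (hpq : p ≠ q) (ha : a ∈ V(G)) (hz : z ∈ V(G))
    (haQ : a ∈ Q) (hap : a ≠ p) (haq : a ≠ q) (hzQ : z ∉ Q) (hzp : z ≠ p) (hzq : z ≠ q) :
    ∃ c d, G.Adj c d ∧ c ∈ Q ∧ c ≠ p ∧ c ≠ q ∧ d ∉ Q ∧ d ≠ p ∧ d ≠ q := by
  by_contra! hcon
  have := hG.2 {p, q} (by grind) (by rw [Set.encard_pair hpq]; norm_num) a (by simp [*]) z
    (by simp [*])
  have key : ∀ w, Relation.ReflTransGen (G.deleteVerts {p, q}).Adj a w → w ∈ Q := by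
    intro w hw
    induction hw with
    | refl => exact haQ
    | tail _ h ih =>
      obtain ⟨e, he⟩ := h
      simp only [deleteVerts_isLink, Set.mem_insert_iff, Set.mem_singleton_iff, not_or] at he
      by_contra hd
      exact he.2.2.2 (hcon _ _ he.1.adj ih he.2.1.1 he.2.1.2 hd he.2.2.1)
  exact hzQ (key z this)

lemma IsKConnected.exists_ne (hG : G.IsKConnected 3) (a b c : α) :
    ∃ z ∈ V(G), z ≠ a ∧ z ≠ b ∧ z ≠ c := by
  by_contra! h
  have h1 : V(G) ⊆ {a, b, c} := by grind
  have h2 := hG.1.trans_le (Set.encard_le_encard h1)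
  have h3 : ({a, b, c} : Set α).encard ≤ 3 := by
    refine (Set.encard_insert_le _ _).trans ?_
    calc _ ≤ (2 : ℕ∞) + 1 := by gcongr; exact encard_pair_le_two b c
      _ = 3 := by norm_num
  exact absurd (h2.trans_le h3) (by simp)

/-- Deleting fewer vertices is harmless: if `q` equals `p` or is not a vertex, a spare vertex `t`,
different from `a`, `z` and `p`, is deleted in its place. `crossing` treats `p` in the same way. -/
lemma IsKConnected.crossing_of_mem (hG : G.IsKConnected 3) (Q : Set α) (hp : p ∈ V(G))
    (ha : a ∈ V(G)) (hz : z ∈ V(G)) (haQ : a ∈ Q) (hap : a ≠ p) (haq : a ≠ q) (hzQ : z ∉ Q)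
    (hzp : z ≠ p) (hzq : z ≠ q) :
    ∃ c d, G.Adj c d ∧ c ∈ Q ∧ c ≠ p ∧ c ≠ q ∧ d ∉ Q ∧ d ≠ p ∧ d ≠ q := by
  by_cases h : q ∈ V(G) ∧ p ≠ q
  · exact hG.crossing_of_ne Q hp h.1 h.2 ha hz haQ hap haq hzQ hzp hzq
  · obtain ⟨t, ht, hta, htz, htp⟩ := hG.exists_ne a z p
    obtain ⟨c, d, hcd, h⟩ := hG.crossing_of_ne Q hp ht htp.symm ha hz haQ hap hta.symm hzQ hzp
      htz.symm
    have := hcd.left_mem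
    have := hcd.right_mem
    exact ⟨c, d, hcd, by grind⟩

lemma IsKConnected.crossing (hG : G.IsKConnected 3) (Q : Set α) (p q : α) (ha : a ∈ V(G))
    (hz : z ∈ V(G)) (haQ : a ∈ Q) (hap : a ≠ p) (haq : a ≠ q) (hzQ : z ∉ Q)
    (hzp : z ≠ p) (hzq : z ≠ q) :
    ∃ c d, G.Adj c d ∧ c ∈ Q ∧ c ≠ p ∧ c ≠ q ∧ d ∉ Q ∧ d ≠ p ∧ d ≠ q := by
  by_cases hp : p ∈ V(G)
  · exact hG.crossing_of_mem Q hp ha hz haQ hap haq hzQ hzp hzq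
  · obtain ⟨t, ht, hta, htz, htp⟩ := hG.exists_ne a z p
    obtain ⟨c, d, hcd, h⟩ := hG.crossing_of_mem (q := q) Q ht ha hz haQ hta.symm haq hzQ
      htz.symm hzq
    have := hcd.left_mem
    have := hcd.right_mem
    exact ⟨c, d, hcd, by grind⟩

/-- An edge leaves `{x}` when `p` and `q` are deleted. If one of them is `x`, which must stay,
another vertex is deleted instead; this causes the case distinction. -/
lemma IsKConnected.exists_adj_ne (hG : G.IsKConnected 3) (hx : x ∈ V(G)) (p q : α) :
    ∃ z, G.Adj x z ∧ z ≠ x ∧ z ≠ p ∧ z ≠ q := by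
  by_cases hxp : x = p
  · obtain ⟨t, ht, htx, htq, -⟩ := hG.exists_ne x q q
    by_cases hxq : x = q
    · obtain ⟨t', ht', htx', htt', -⟩ := hG.exists_ne x t t
      obtain ⟨c, d, h⟩ := hG.crossing {x} t' t' (a := x) (z := t) hx ht rfl (by grind) (by grind)
        (by grind) (by grind) (by grind)
      exact ⟨d, by grind⟩
    · obtain ⟨t', ht', htx', htt', htq'⟩ := hG.exists_ne x t q
      obtain ⟨c, d, h⟩ := hG.crossing {x} t' q (a := x) (z := t) hx ht rfl (by grind) (by grind)
        (by grind) (by grind) (by grind)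
      exact ⟨d, by grind⟩
  · by_cases hxq : x = q
    · obtain ⟨t, ht, htx, htq, -⟩ := hG.exists_ne x p p
      obtain ⟨c, d, h⟩ := hG.crossing {x} p p (a := x) (z := t) hx ht rfl (by grind) (by grind)
        (by grind) (by grind) (by grind)
      exact ⟨d, by grind⟩
    · obtain ⟨t, ht, htx, htq, _⟩ := hG.exists_ne x p q
      obtain ⟨c, d, h⟩ := hG.crossing {x} p q (a := x) (z := t) hx ht rfl (by grind) (by grind)
        (by grind) (by grind) (by grind)
      exact ⟨d, by grind⟩

lemma IsKConnected.three_le_encard_nbrs (hG : G.IsKConnected 3) (hx : x ∈ V(G)) :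
    3 ≤ (G.nbrs x).encard := by
  obtain ⟨a, ha, -⟩ := hG.exists_adj_ne hx x x
  obtain ⟨b, hb, -, hba, -⟩ := hG.exists_adj_ne hx a a
  obtain ⟨c, hc, -, hca, hcb⟩ := hG.exists_adj_ne hx a b
  exact three_le_encard ha hb hc hba.symm hca.symm hcb.symm

lemma IsKConnected.not_isSmoothable (hG : G.IsKConnected 3) (hx : x ∈ V(G)) :
    ¬ G.IsSmoothable x := by
  intro h
  have := hG.three_le_encard_nbrs hx
  rw [h.2.1] at this
  norm_num at this

end Connectivity

/-! ### Smoothing and subdividing are inverse to each other. -/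

section Smoothing

variable {α β : Type*} {G H K : Graph α β} {a b c d p q u v w x y z : α} {e f g : β}

lemma loopSet_eq_empty (hG : G.Loopless) : G.loopSet x = ∅ := by
  ext e
  simp

/-- Smoothing a vertex is inverse to subdividing the resulting edge. -/
lemma IsSmoothable.isSubdividing (hK : K.Loopless) (hy : K.IsSmoothable y)
    (hN : K.nbrs y = {c, d}) (hg : g ∉ E(K.deleteVerts {y})) :
    ((K.deleteVerts {y}).addEdge g c d).IsSubdividing g y K := by
  obtain ⟨hdeg, hN2, hyN⟩ := hy
  have hcd : c ≠ d := by
    rintro rfl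
    simp [hN] at hN2
  obtain ⟨e₁, h1⟩ : K.Adj y c := by rw [← mem_nbrs, hN]; simp
  obtain ⟨e₂, h2⟩ : K.Adj y d := by rw [← mem_nbrs, hN]; simp
  have hcy : y ≠ c := h1.ne
  have hdy : y ≠ d := h2.ne
  have h12 : e₁ ≠ e₂ := by
    rintro rfl
    exact hcd (h1.right_unique h2)
  have hinc : K.incidenceSet y = {e₁, e₂} := by
    rw [deg, loopSet_eq_empty hK, Set.encard_empty, add_zero] at hdeg
    symm
    apply Set.Finite.eq_of_subset_of_encard_le
    · exact Set.toFinite _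
    · rintro e (rfl | rfl)
      · exact h1.inc_left
      · exact h2.inc_left
    · rw [hdeg, Set.encard_pair h12]
  have hinc' : ∀ e u, K.IsLink e y u → e = e₁ ∨ e = e₂ := by
    intro e u h
    have : e ∈ K.incidenceSet y := ⟨u, h⟩
    rwa [hinc] at this
  have hg' : ∀ u v, K.IsLink g u v → u = y ∨ v = y := by
    intro u v h
    by_contra! hcon
    apply hg
    simp only [edgeSet_deleteVerts, Set.mem_ofPred_eq]
    exact ⟨u, v, h, by simp [hcon]⟩
  have hl1 := @IsLink.eq_and_eq_or_eq_and_eq _ _ y c e₁ K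
  have hl2 := @IsLink.eq_and_eq_or_eq_and_eq _ _ y d e₂ K
  refine ⟨c, d, e₁, e₂, by simp, by simp [hcy, hdy], h12, ?_, ?_, ?_⟩
  · simp only [mem_edgeSet_iff, deleteEdges_isLink, addEdge_isLink, deleteVerts_isLink]
    grind
  · simp only [mem_edgeSet_iff, deleteEdges_isLink, addEdge_isLink, deleteVerts_isLink]
    grind
  · ext e u v
    · simp; grind
    · simp only [deleteEdges_isLink, addEdge_isLink, deleteVerts_isLink, Set.mem_singleton_iff]
      have hs := @IsLink.symm _ _ u v e K
      have h1s := h1.symm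
      have h2s := h2.symm
      grind

/-- Converse of `IsSmoothable.isSubdividing`. As `G` is loopless, the subdividing vertex has two
distinct neighbours, and smoothing it with the old label `g` recovers `G`. -/
lemma IsSubdividing.exists_nbrs (hG : G.Loopless) (h : G.IsSubdividing g y K) :
    ∃ c d, K.IsSmoothable y ∧ K.nbrs y = {c, d} ∧ c ≠ d ∧ y ∉ V(G) ∧ G.IsLink g c d ∧
      g ∉ E(K.deleteVerts {y}) ∧ G = (K.deleteVerts {y}).addEdge g c d := by
  obtain ⟨c, d, e₁, e₂, hgl, hy, h12, he1, he2, rfl⟩ := h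
  have hcd : c ≠ d := hgl.ne
  have hlinky : ∀ e u, ¬ G.IsLink e y u := fun e u h => hy h.left_mem
  have hlinky' : ∀ e u, ¬ G.IsLink e u y := fun e u h => hy h.right_mem
  have hc := hgl.left_mem
  have hd := hgl.right_mem
  have hcy : c ≠ y := by grind
  have hdy : d ≠ y := by grind
  -- The new labels may reuse `g`, which is free once the edge is deleted; no other label of `G` can
  -- recur.
  have he1' : ∀ u v, G.IsLink e₁ u v → e₁ = g := by
    intro u v h
    by_contra h'
    exact he1 (by simp [h.edge_mem, h'])
  have he2' : ∀ u v, G.IsLink e₂ u v → e₂ = g := by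
    intro u v h
    by_contra h'
    exact he2 (by simp [h.edge_mem, h'])
  have hN : ((G.deleteEdges {g}).addEdge e₁ c y |>.addEdge e₂ y d).nbrs y = {c, d} := by
    ext u
    simp only [mem_nbrs, Adj, addEdge_isLink, deleteEdges_isLink]
    constructor
    · grind
    · rintro (rfl | rfl)
      · exact ⟨e₁, by grind⟩
      · exact ⟨e₂, by grind⟩
  have hI : ((G.deleteEdges {g}).addEdge e₁ c y |>.addEdge e₂ y d).incidenceSet y = {e₁, e₂} := by
    ext e
    simp only [mem_incidenceSet, Inc, addEdge_isLink, deleteEdges_isLink]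
    constructor
    · grind
    · rintro (rfl | rfl)
      · exact ⟨c, by grind⟩
      · exact ⟨d, by grind⟩
  refine ⟨c, d, ⟨?_, ?_, ?_⟩, hN, hcd, hy, hgl, ?_, ?_⟩
  · have hL : ((G.deleteEdges {g}).addEdge e₁ c y |>.addEdge e₂ y d).Loopless :=
      Loopless.addEdge (Loopless.addEdge (hG.anti deleteEdges_le) hcy) hdy.symm
    rw [deg, loopSet_eq_empty hL, hI, Set.encard_pair h12]
    simp
  · rw [hN, Set.encard_pair hcd]
  · rw [hN]; grind
  · simp only [mem_edgeSet_iff, addEdge_isLink, deleteEdges_isLink, deleteVerts_isLink]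
    grind
  · ext e u v
    · simp; grind
    · simp only [addEdge_isLink, deleteEdges_isLink, deleteVerts_isLink, Set.mem_singleton_iff]
      have := @IsLink.eq_and_eq_or_eq_and_eq _ _ c d g G
      have hs := hgl.symm
      have h3 := he1' u v
      have h4 := he2' u v
      have h5 := hlinky e v
      have h6 := hlinky' e u
      grind

end Smoothing

end Graph

namespace Graph

/-! ### Good removals are the inverses of BG-operations. -/

section GoodRemoval

variable {α β : Type*} {G H K H' : Graph α β} {a b c d p q u v w x y z : α} {e f g : β}

lemma nbrs_deleteEdges_of_isLink (h : G.IsLink e x y) :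
    G.nbrs x = (G.deleteEdges {e}).nbrs x ∪ (G.nbrs x ∩ {y}) := by
  ext w
  simp only [mem_nbrs, Set.mem_union, Set.mem_inter_iff, Set.mem_singleton_iff, Adj,
    deleteEdges_isLink]
  have := fun z (hz : G.IsLink e x z) => hz.right_unique h
  grind

/-- Deleting `xy` costs `x` at most the neighbour `y`, so a third neighbour besides `a`, `b` has to
be `y`. This is the role of the conditions `|N(x)| ≥ 3` and `|N(y)| ≥ 3`. -/
lemma notMem_pair_of_three_le (hN : 3 ≤ (G.nbrs x).encard) (h : G.IsLink e x y)
    (hab : (G.deleteEdges {e}).nbrs x = {a, b}) : y ≠ a ∧ y ≠ b := by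
  rw [nbrs_deleteEdges_of_isLink h, hab] at hN
  obtain ⟨z, hz, hza, hzb⟩ := exists_ne_ne_of_three_le hN a b
  have hzy : z = y := by grind
  grind

/-- The type of the operation is the number of ends that get smoothed: none for `add`, one for
`subdivideOne`, two for `subdivideTwo`. -/
lemma IsGoodRemoval.isBGOp (hL : H'.Loopless) (h : H'.IsGoodRemoval e H) : H.IsBGOp e H' := by
  obtain ⟨x, y, ⟨hl, K, hx, hy⟩, h3, hNx, hNy, hNxy⟩ := h
  have hxy : x ≠ y := hl.ne
  have hDL : (H'.deleteEdges {e}).Loopless := hL.anti deleteEdges_le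
  have hH' := addEdge_deleteEdges hl
  have heD := @notMem_edgeSet_deleteEdges _ _ H' e
  generalize hD : H'.deleteEdges {e} = D at *
  have hVD : V(D) = V(H') := by rw [← hD]; simp
  rcases hx with ⟨hxs, a, b, f, hab, hf, rfl⟩ | ⟨hxs, rfl⟩
  · have hyab := notMem_pair_of_three_le hNx hl (hD ▸ hab)
    have hsub := hxs.isSubdividing hDL hab hf
    have hne : a ≠ b := by
      rintro rfl
      have := hxs.2.1
      simp [hab] at this
    have hxab : x ≠ a ∧ x ≠ b := by
      have := hxs.2.2
      rw [hab] at this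
      grind
    have hKL : ((D.deleteVerts {x}).addEdge f a b).Loopless :=
      Loopless.addEdge (hDL.anti deleteVerts_le) hne
    have hfK : ((D.deleteVerts {x}).addEdge f a b).IsLink f a b := by simp
    have hyK : y ∈ V((D.deleteVerts {x}).addEdge f a b) := by
      simp [hVD, hl.right_mem, hxy.symm]
    -- Smoothing `x` does not affect the neighbours of `y`, because `y` is neither `a` nor `b`.
    have hNK : ((D.deleteVerts {x}).addEdge f a b).nbrs y = D.nbrs y := by
      ext w
      rw [mem_nbrs, addEdge_adj_of_notMem hf, mem_nbrs]
      simp only [Adj, deleteVerts_isLink, Set.mem_singleton_iff]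
      constructor
      · grind
      · rintro ⟨e', he'⟩
        refine Or.inl ⟨e', he', hxy.symm, ?_⟩
        rintro rfl
        have : y ∈ D.nbrs w := he'.symm.adj
        rw [hab] at this
        grind
    generalize hK : (D.deleteVerts {x}).addEdge f a b = K at *
    rcases hy with ⟨hys, c, d, g, hcd, hg, rfl⟩ | ⟨hys, rfl⟩
    · have hsub' := hys.isSubdividing hKL hcd hg
      have hcd' : c ≠ d := by
        rintro rfl
        have := hys.2.1
        simp [hcd] at this
      have hfH : f ∈ E(K.deleteVerts {y}) := by
        simp only [edgeSet_deleteVerts, Set.mem_ofPred_eq]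
        exact ⟨a, b, hfK, by simp [Ne.symm hyab.1], by simp [Ne.symm hyab.2]⟩
      have hfg : f ≠ g := fun h => hg (h ▸ hfH)
      rw [← hH', addEdge_comm (G := D)]
      -- The vertex smoothed last is the one subdivided first.
      refine .subdivideTwo g f y x K D h3 ?_ ?_ hfg.symm ?_ hsub' hsub heD
      · rw [mem_edgeSet_addEdge]; simp
      · rw [mem_edgeSet_addEdge]; exact Or.inr hfH
      · rintro ⟨p, q, hgl, hfl⟩
        -- Parallel edges would have the same two ends, so that `N(x) ∪ N(y)` had at most four
        -- elements.
        have hset : ({a, b} : Set α) = {c, d} := by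
          have h2 := hfK.eq_and_eq_or_eq_and_eq (x' := p) (y' := q) (by simp_all)
          have h4 : p = c ∧ q = d ∨ p = d ∧ q = c := by simpa using hgl
          grind
        have h1 : H'.nbrs x ∪ H'.nbrs y ⊆ {x, y, a, b} := by
          rw [nbrs_deleteEdges_of_isLink hl, nbrs_deleteEdges_of_isLink hl.symm, hD, hab,
            ← hNK, hcd, ← hset]
          grind
        have h2 := hNxy.trans (Set.encard_le_encard h1)
        have h3 : ({x, y, a, b} : Set α).encard ≤ 4 := by
          refine (Set.encard_insert_le _ _).trans ?_
          calc _ ≤ ((2 : ℕ∞) + 1) + 1 := by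
                gcongr
                refine (Set.encard_insert_le _ _).trans ?_
                gcongr
                exact encard_pair_le_two _ _
            _ = 4 := by norm_num
        have := h2.trans h3
        norm_num at this
    · rw [← hH']
      refine .subdivideOne f x y D h3 hsub hyK ?_ heD
      intro hinc
      have := hinc.eq_or_eq_of_isLink hfK
      grind
  · rcases hy with ⟨hys, c, d, g, hcd, hg, rfl⟩ | ⟨hys, rfl⟩
    · have hxcd := notMem_pair_of_three_le hNy hl.symm (hD ▸ hcd)
      have hsub := hys.isSubdividing hDL hcd hg
      rw [← hH', addEdge_comm (G := K)]
      refine .subdivideOne g y x K h3 hsub ?_ ?_ heD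
      · simp [hVD, hl.left_mem, hxy]
      · intro hinc
        have := hinc.eq_or_eq_of_isLink (show IsLink _ g c d by simp)
        grind
    · rw [← hH']
      exact .add x y h3 (hVD ▸ hl.left_mem) (hVD ▸ hl.right_mem) hxy heD

lemma IsGoodRemoval.loopless (hL : H'.Loopless) (h : H'.IsGoodRemoval e H) : H.Loopless := by
  have key : ∀ (A B : Graph α β) (v : α), A.Loopless → A.IsSmoothing v B → B.Loopless := by
    rintro A B v hA (⟨hv, a, b, f, hab, -, rfl⟩ | ⟨-, rfl⟩)
    · refine Loopless.addEdge (hA.anti deleteVerts_le) ?_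
      rintro rfl
      have := hv.2.1
      simp [hab] at this
    · exact hA
  obtain ⟨x, y, ⟨hl, K, hx, hy⟩, -⟩ := h
  exact key _ _ _ (key _ _ _ (hL.anti deleteEdges_le) hx) hy

lemma IsGoodRemoval.five_le (h : H'.IsGoodRemoval e H) : 5 ≤ V(H').encard := by
  obtain ⟨x, y, -, -, -, -, h5⟩ := h
  refine h5.trans (Set.encard_le_encard ?_)
  rintro z (hz | hz)
  · exact hz.right_mem
  · exact hz.right_mem

lemma nbrs_addEdge_left (hg : g ∉ E(G)) : (G.addEdge g x y).nbrs x = insert y (G.nbrs x) := by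
  ext w
  rw [mem_nbrs, addEdge_adj_of_notMem hg]
  simp only [Set.mem_insert_iff, mem_nbrs]
  grind

lemma nbrs_addEdge_right (hg : g ∉ E(G)) : (G.addEdge g x y).nbrs y = insert x (G.nbrs y) := by
  rw [addEdge_comm, nbrs_addEdge_left hg]

lemma IsSubdividing.mem_vertexSet (h : G.IsSubdividing e x K) : x ∈ V(K) := by
  obtain ⟨a, b, e₁, e₂, -, -, -, -, -, rfl⟩ := h
  simp

lemma IsSubdividing.subset_vertexSet (h : G.IsSubdividing e x K) : V(G) ⊆ V(K) := by
  obtain ⟨a, b, e₁, e₂, -, -, -, -, -, rfl⟩ := h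
  simp
  grind

lemma IsSubdividing.vertexSet_eq (h : G.IsSubdividing e x K) : V(K) = insert x V(G) := by
  obtain ⟨a, b, e₁, e₂, hl, -, -, -, -, rfl⟩ := h
  have := hl.left_mem
  have := hl.right_mem
  simp
  grind

lemma IsSubdividing.loopless (hG : G.Loopless) (h : G.IsSubdividing e x K) : K.Loopless := by
  obtain ⟨a, b, e₁, e₂, hl, hx, -, -, -, rfl⟩ := h
  have := hl.left_mem
  have := hl.right_mem
  exact Loopless.addEdge (Loopless.addEdge (hG.anti deleteEdges_le) (by grind)) (by grind)

lemma IsSubdividing.isLink_of_ne (h : G.IsSubdividing e x K) (hf : G.IsLink f u v)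
    (hfe : f ≠ e) : K.IsLink f u v := by
  obtain ⟨a, b, e₁, e₂, hl, hx, -, h1, h2, rfl⟩ := h
  have h3 := hf.edge_mem
  simp only [edgeSet_deleteEdges, Set.mem_sdiff, Set.mem_singleton_iff] at h1 h2
  simp only [addEdge_isLink, deleteEdges_isLink, Set.mem_singleton_iff]
  grind

lemma IsSubdividing.nbrs_of_not_inc (h : G.IsSubdividing e x K) (hy : y ∈ V(G))
    (hye : ¬ G.Inc e y) : K.nbrs y = G.nbrs y := by
  obtain ⟨a, b, e₁, e₂, hl, hx, h12, h1, h2, rfl⟩ := h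
  have ha := hl.inc_left
  have hb := hl.inc_right
  have hya : y ≠ a := by grind
  have hyb : y ≠ b := by grind
  have hyx : y ≠ x := by grind
  ext w
  simp only [mem_nbrs]
  rw [addEdge_adj_of_notMem, addEdge_adj_of_notMem h1]
  · have : (G.deleteEdges {e}).Adj y w ↔ G.Adj y w := by
      simp only [Adj, deleteEdges_isLink, Set.mem_singleton_iff]
      constructor
      · grind
      · rintro ⟨e', he'⟩
        refine ⟨e', he', ?_⟩
        rintro rfl
        exact hye he'.inc_left
    rw [this]
    grind
  · rw [mem_edgeSet_addEdge]
    grind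

/-- In the two subdividing operations five neighbours are found directly: `x` and `y`, together with
either three neighbours of the old vertex `y` or three ends of non-parallel edges. The bound on the
number of vertices is needed for `add` only. -/
lemma IsBGOp.isGoodRemoval (hL : H.Loopless) (h : H.IsBGOp e H') (h5 : 5 ≤ V(H').encard) :
    H'.IsGoodRemoval e H := by
  induction h with
  | add x y h3 hx hy hxy hg =>
    refine ⟨x, y, ⟨by simp, H, Or.inr ?_, Or.inr ⟨h3.not_isSmoothable hy, rfl⟩⟩, h3, ?_, ?_, ?_⟩
    · rw [deleteEdges_addEdge hg hx hy]
      exact ⟨h3.not_isSmoothable hx, rfl⟩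
    · rw [nbrs_addEdge_left hg]
      exact (h3.three_le_encard_nbrs hx).trans (Set.encard_le_encard (by simp))
    · rw [nbrs_addEdge_right hg]
      exact (h3.three_le_encard_nbrs hy).trans (Set.encard_le_encard (by simp))
    · rw [nbrs_addEdge_left hg, nbrs_addEdge_right hg]
      obtain ⟨p, hp, hpx, hpy, -⟩ := h3.exists_adj_ne hx y y
      obtain ⟨q, hq, hqx, hqy, hqp⟩ := h3.exists_adj_ne hx y p
      -- The set `{x, y}` needs a third neighbour `r`; otherwise `p` and `q` would separate it from
      -- a fifth vertex.
      have hmem : ∃ r, (H.Adj x r ∨ H.Adj y r) ∧ r ≠ x ∧ r ≠ y ∧ r ≠ p ∧ r ≠ q := by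
        have hV : V(H.addEdge e x y) = V(H) := by simp; grind
        rw [hV] at h5
        have : ∃ z ∈ V(H), z ≠ x ∧ z ≠ y ∧ z ≠ p ∧ z ≠ q := by
          by_contra! hcon
          have h6 : V(H) ⊆ {x, y, p, q} := by grind
          have h7 := h5.trans (Set.encard_le_encard h6)
          rw [Set.encard_insert_of_notMem (by grind), Set.encard_insert_of_notMem (by grind),
            Set.encard_pair (by grind)] at h7
          norm_num at h7
        obtain ⟨z, hz, hzx, hzy, hzp, hzq⟩ := this
        obtain ⟨c, d, hcd, h⟩ := h3.crossing {x, y} p q (a := x) (z := z) hx hz (by simp)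
          (by grind) (by grind) (by grind) (by grind) (by grind)
        exact ⟨d, by grind⟩
      obtain ⟨r, hr, hrx, hry, hrp, hrq⟩ := hmem
      have hsub : ({x, y, p, q, r} : Set α) ⊆ insert y (H.nbrs x) ∪ insert x (H.nbrs y) := by
        rintro z hz
        simp only [Set.mem_insert_iff, Set.mem_singleton_iff] at hz
        simp only [Set.mem_union, Set.mem_insert_iff, mem_nbrs]
        grind
      refine le_trans ?_ (Set.encard_le_encard hsub)
      rw [Set.encard_insert_of_notMem (by grind), Set.encard_insert_of_notMem (by grind),
        Set.encard_insert_of_notMem (by grind), Set.encard_pair (by grind)]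
      norm_num
  | subdivideOne f x y K h3 hK hy hye hg =>
    obtain ⟨a, b, hs, hN, hab, hx, hl, hf, hH⟩ := hK.exists_nbrs hL
    have hxK := hK.mem_vertexSet
    have hyK := hK.subset_vertexSet hy
    have hya : y ≠ a := by rintro rfl; exact hye hl.inc_left
    have hyb : y ≠ b := by rintro rfl; exact hye hl.inc_right
    have hNy := hK.nbrs_of_not_inc hy hye
    have hNy3 := h3.three_le_encard_nbrs hy
    have hxy : x ≠ y := by grind
    refine ⟨x, y, ⟨by simp, H, Or.inl ?_, Or.inr ⟨h3.not_isSmoothable hy, rfl⟩⟩, h3, ?_, ?_, ?_⟩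
    · rw [deleteEdges_addEdge hg hxK hyK]
      exact ⟨hs, a, b, f, hN, hf, hH⟩
    · rw [nbrs_addEdge_left hg, hN]
      exact three_le_encard (a := y) (b := a) (c := b) (by simp) (by simp) (by simp) hya hyb hab
    · rw [nbrs_addEdge_right hg, hNy]
      exact hNy3.trans (Set.encard_le_encard (by simp))
    · rw [nbrs_addEdge_left hg, nbrs_addEdge_right hg, hN, hNy]
      have hxN : x ∉ H.nbrs y := fun h => hx h.right_mem
      have hyN : y ∉ H.nbrs y := fun h => h.ne rfl
      have h4 := succ_le_encard_of_notMem hNy3 (Set.subset_insert x _) hxN (by simp)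
      have h5 := succ_le_encard_of_notMem (t := insert y {a, b} ∪ insert x (H.nbrs y)) h4
        (fun z hz => Or.inr hz) (a := y) (by simp [hyN, hxy.symm]) (by simp)
      refine le_trans ?_ h5
      norm_num
  | subdivideTwo f g x y K L h3 hf hg' hfg hpar hK hL' hg =>
    obtain ⟨a, b, hs, hN, hab, hx, hl, hf', hH⟩ := hK.exists_nbrs hL
    obtain ⟨c, d, hs', hN', hcd, hy, hl', hg', hK'⟩ := hL'.exists_nbrs (hK.loopless hL)
    have hxK := hK.mem_vertexSet
    have hxL := hL'.subset_vertexSet hxK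
    have hyL := hL'.mem_vertexSet
    have hxy : x ≠ y := by grind
    have hglink : H.IsLink g c d := by
      obtain ⟨u, v, huv⟩ := exists_isLink_of_mem_edgeSet ‹g ∈ E(H)›
      have := hK.isLink_of_ne huv hfg.symm
      rcases this.eq_and_eq_or_eq_and_eq hl' with ⟨rfl, rfl⟩ | ⟨rfl, rfl⟩
      · exact huv
      · exact huv.symm
    have hset : ({a, b} : Set α) ≠ {c, d} := by
      intro h
      apply hpar
      refine ⟨a, b, hl, ?_⟩
      have : c = a ∧ d = b ∨ c = b ∧ d = a := by
        have : c ∈ ({a, b} : Set α) := by rw [h]; simp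
        have : d ∈ ({a, b} : Set α) := by rw [h]; simp
        grind
      rcases this with ⟨rfl, rfl⟩ | ⟨rfl, rfl⟩
      · exact hglink
      · exact hglink.symm
    have hyab : y ≠ a ∧ y ≠ b := by
      have := hK.subset_vertexSet hl.left_mem
      have := hK.subset_vertexSet hl.right_mem
      grind
    have hxcd : x ≠ c ∧ x ≠ d := by
      have := hglink.left_mem
      have := hglink.right_mem
      grind
    have hxab : x ≠ a ∧ x ≠ b := by
      have := hl.left_mem
      have := hl.right_mem
      grind
    have hycd : y ≠ c ∧ y ≠ d := by
      have := hl'.left_mem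
      have := hl'.right_mem
      grind
    have hNx : L.nbrs x = {a, b} := by
      rw [← hN]
      refine hL'.nbrs_of_not_inc hxK ?_
      intro h
      have := h.eq_or_eq_of_isLink hl'
      grind
    -- The ends are taken in this order since `y`, which was inserted last, is smoothed first.
    refine ⟨y, x, ⟨by simp, K, Or.inl ?_, Or.inl ⟨hs, a, b, f, hN, hf', hH⟩⟩, h3, ?_, ?_, ?_⟩
    · rw [deleteEdges_addEdge hg hxL hyL]
      exact ⟨hs', c, d, g, hN', hg', hK'⟩
    · rw [nbrs_addEdge_right hg, hN']
      exact three_le_encard (a := x) (b := c) (c := d) (by simp) (by simp) (by simp) hxcd.1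
        hxcd.2 hcd
    · rw [nbrs_addEdge_left hg, hNx]
      exact three_le_encard (a := y) (b := a) (c := b) (by simp) (by simp) (by simp) hyab.1
        hyab.2 hab
    · rw [nbrs_addEdge_left hg, nbrs_addEdge_right hg, hNx, hN']
      have : ∃ z, (z = c ∨ z = d) ∧ z ≠ a ∧ z ≠ b := by
        by_contra! hcon
        have h1 := hcon c (Or.inl rfl)
        have h2 := hcon d (Or.inr rfl)
        apply hset
        by_cases hca : c = a
        · rw [hca, h2 (by grind)]
        · rw [h1 hca, show d = a by grind, Set.pair_comm]
      obtain ⟨z, hz, hza, hzb⟩ := this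
      have hsub : ({x, y, a, b, z} : Set α) ⊆ insert x {c, d} ∪ insert y {a, b} := by grind
      refine le_trans ?_ (Set.encard_le_encard hsub)
      rw [Set.encard_insert_of_notMem (by grind), Set.encard_insert_of_notMem (by grind),
        Set.encard_insert_of_notMem (by grind), Set.encard_pair (by grind)]
      norm_num

lemma IsBGOp.isKConnected_left (h : H.IsBGOp e H') : H.IsKConnected 3 := by
  cases h <;> assumption

/-- Delete the other two vertices: what remains is connected and consists of `x` and `y`. -/
lemma adj_of_encard_eq_four (hG : G.IsKConnected 3) (h4 : V(G).encard = 4) (hx : x ∈ V(G))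
    (hy : y ∈ V(G)) (hxy : x ≠ y) : G.Adj x y := by
  obtain ⟨p, hp, hpx, hpy, -⟩ := hG.exists_ne x y y
  obtain ⟨q, hq, hqx, hqy, hqp⟩ := hG.exists_ne x y p
  have hV : ({x, y, p, q} : Set α) = V(G) := by
    apply Set.Finite.eq_of_subset_of_encard_le (Set.toFinite _)
    · grind
    · rw [h4, Set.encard_insert_of_notMem (by grind), Set.encard_insert_of_notMem (by grind),
        Set.encard_pair (by grind)]
      norm_num
  obtain ⟨c, d, hcd, h⟩ := hG.crossing {x} p q (a := x) (z := y) hx hy rfl (by grind) (by grind)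
    (by grind) (by grind) (by grind)
  have : d ∈ V(G) := hcd.right_mem
  rw [← hV] at this
  have : d = y := by grind
  grind

/-- A subdivision adds a vertex to the at least four of `H`. Adding an edge to a 3-connected graph
on four vertices is not basic, because any two vertices are already adjacent. -/
lemma IsBasicBGOp.five_le (hL : H.Loopless) (h : H.IsBasicBGOp e H') : 5 ≤ V(H').encard := by
  obtain ⟨h, hb⟩ := h
  have key : ∀ (s : Set α) (x : α), x ∉ V(H) → x ∈ s → V(H) ⊆ s → 3 < V(H).encard →
      5 ≤ s.encard := by
    intro s x hx hxs hs h3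
    have h4 : (4 : ℕ∞) ≤ V(H).encard := by
      have := Order.add_one_le_of_lt h3
      norm_num at this
      exact this
    exact succ_le_encard_of_notMem h4 hs hx hxs
  cases h with
  | add x y h3 hx hy hxy hg =>
    have hV : V(H.addEdge e x y) = V(H) := by simp; grind
    rw [hV]
    have h4 := Order.add_one_le_of_lt h3.1
    have h4 : (4 : ℕ∞) ≤ V(H).encard := by
      norm_num at h4
      exact h4
    rcases h4.eq_or_lt with h4 | h4
    · obtain ⟨f, hf⟩ := adj_of_encard_eq_four h3 h4.symm hx hy hxy
      have hfe : f ≠ e := fun h => hg (h ▸ hf.edge_mem)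
      exact absurd (hb e f x y hfe.symm (by simp) (by simp [hfe, hf])).1.edge_mem hg
    · have := Order.add_one_le_of_lt h4
      norm_num at this
      exact this
  | subdivideOne f x y K h3 hK hy hye hg =>
    obtain ⟨a, b, -, -, -, hx, -⟩ := hK.exists_nbrs hL
    have := hK.vertexSet_eq
    exact key _ x hx (by simp) (by simp; grind) h3.1
  | subdivideTwo f g x y K L h3 hf hg' hfg hpar hK hL' hg =>
    obtain ⟨a, b, -, -, -, hx, -⟩ := hK.exists_nbrs hL
    have := hK.vertexSet_eq
    have := hL'.vertexSet_eq
    exact key _ x hx (by simp) (by simp; grind) h3.1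

theorem isGoodRemoval_iff (hH : H.Loopless) (hH' : H'.Loopless) :
    H'.IsGoodRemoval e H ↔ H.IsBGOp e H' ∧ 5 ≤ V(H').encard :=
  ⟨fun h => ⟨h.isBGOp hH', h.five_le⟩, fun h => h.1.isGoodRemoval hH h.2⟩

lemma IsBasicBGOp.isGoodRemoval (hH : H.Loopless) (h : H.IsBasicBGOp e H') :
    H'.IsGoodRemoval e H :=
  h.1.isGoodRemoval hH (h.five_le hH)

end GoodRemoval

end Graph

namespace Graph

/-! ### BG-operations preserve 3-connectivity. -/

section Preservation

/-- Used when a new vertex is among the two deleted ones: `r` is then the other deleted vertex. -/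
lemma exists_other {α : Type*} {p q : α} (hpq : p ≠ q) {x : α} (hx : x = p ∨ x = q) :
    ∃ r, r ≠ x ∧ (r = p ∨ r = q) ∧ ∀ t, t ≠ x → t ≠ r → t ≠ p ∧ t ≠ q := by
  rcases hx with rfl | rfl
  · exact ⟨q, hpq.symm, Or.inr rfl, fun t h1 h2 => ⟨h1, h2⟩⟩
  · exact ⟨p, hpq, Or.inl rfl, fun t h1 h2 => ⟨h2, h1⟩⟩

variable {α β : Type*} {G H K : Graph α β} {a b c d p q s t u v w x y z : α} {e f g : β}

/-- In a 3-connected graph, no vertex together with a pair of adjacent vertices forms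
a mixed cut. -/
lemma IsKConnected.exists_crossing_ne_pair (hG : G.IsKConnected 3) (Q : Set α) (p a b : α)
    (hs : s ∈ V(G)) (hz : z ∈ V(G)) (hsQ : s ∈ Q) (hsp : s ≠ p) (hzQ : z ∉ Q) (hzp : z ≠ p) :
    ∃ u v, G.Adj u v ∧ u ∈ Q ∧ u ≠ p ∧ v ∉ Q ∧ v ≠ p ∧ ¬ (u = a ∧ v = b ∨ u = b ∧ v = a) := by
  by_contra! hcon
  -- If `ab` were the only crossing edge, delete its end on the side of a further vertex `t`: both
  -- sides stay inhabited, yet no crossing edge is left.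
  have key : ∀ a b, (∀ u v, G.Adj u v → u ∈ Q → u ≠ p → v ∉ Q → v ≠ p →
      (u = a ∧ v = b ∨ u = b ∧ v = a)) → G.Adj a b → a ∈ Q → b ∉ Q → a ≠ p → b ≠ p → False := by
    intro a b hab hadj ha hb hap hbp
    obtain ⟨t, ht, hta, htb, htp⟩ := hG.exists_ne a b p
    by_cases htQ : t ∈ Q
    · obtain ⟨u, v, huv, h⟩ := hG.crossing Q a p ht hadj.right_mem htQ hta htp hb (by grind) hbp
      grind
    · obtain ⟨u, v, huv, h⟩ := hG.crossing Q b p hadj.left_mem ht ha (by grind) hap htQ htb htp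
      grind
  obtain ⟨u, v, huv, hu, hup, -, hv, hvp, -⟩ := hG.crossing Q p p hs hz hsQ hsp hsp hzQ hzp hzp
  exact key u v (by grind) huv hu hv hup hvp

/-- There is no cut of two edges. If `cd` crosses, one of its ends is not the only vertex on its
side; deleting that end instead of the edge reduces to `exists_crossing_ne_pair`. -/
lemma IsKConnected.exists_crossing_ne_pairs (hG : G.IsKConnected 3) (Q : Set α) (a b c d : α)
    (hs : s ∈ V(G)) (hz : z ∈ V(G)) (hsQ : s ∈ Q) (hzQ : z ∉ Q) :
    ∃ u v, G.Adj u v ∧ u ∈ Q ∧ v ∉ Q ∧ ¬ (u = a ∧ v = b ∨ u = b ∧ v = a) ∧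
      ¬ (u = c ∧ v = d ∨ u = d ∧ v = c) := by
  obtain ⟨t, ht, hts, htz, -⟩ := hG.exists_ne s z z
  by_contra hcon'
  have hcon : ∀ u v, G.Adj u v → u ∈ Q → v ∉ Q → (u = a ∧ v = b ∨ u = b ∧ v = a) ∨
      (u = c ∧ v = d ∨ u = d ∧ v = c) := by
    intro u v h1 h2 h3
    by_contra h
    exact hcon' ⟨u, v, h1, h2, h3, fun h' => h (Or.inl h'), fun h' => h (Or.inr h')⟩
  clear hcon'
  have key : ∀ c d, (∀ u v, G.Adj u v → u ∈ Q → v ∉ Q → (u = a ∧ v = b ∨ u = b ∧ v = a) ∨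
      (u = c ∧ v = d ∨ u = d ∧ v = c)) → c ∈ Q → d ∉ Q → False := by
    intro c d hall hc hd
    by_cases hex : ∃ t' ∈ V(G), t' ∈ Q ∧ t' ≠ c
    · obtain ⟨t', ht', htQ, htc⟩ := hex
      obtain ⟨u, v, huv, hu, huc, hv, hvc, h⟩ :=
        hG.exists_crossing_ne_pair Q c a b ht' hz htQ htc hzQ (fun h => hzQ (h ▸ hc))
      rcases hall u v huv hu hv with h' | ⟨h', -⟩ | ⟨-, h'⟩
      exacts [h h', huc h', hvc h']
    · have hex2 : ∃ t' ∈ V(G), t' ∉ Q ∧ t' ≠ d := by grind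
      obtain ⟨t', ht', htQ, htc⟩ := hex2
      obtain ⟨u, v, huv, hu, hud, hv, hvd, h⟩ :=
        hG.exists_crossing_ne_pair Q d a b hs ht' hsQ (fun h => hd (h ▸ hsQ)) htQ htc
      rcases hall u v huv hu hv with h' | ⟨-, h'⟩ | ⟨h', -⟩
      exacts [h h', hvd h', hud h']
  by_cases h1 : c ∈ Q ∧ d ∉ Q
  · exact key c d hcon h1.1 h1.2
  by_cases h2 : d ∈ Q ∧ c ∉ Q
  · exact key d c (fun u v h1 h2 h3 => (hcon u v h1 h2 h3).imp_right Or.symm) h2.1 h2.2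
  have hall : ∀ u v, G.Adj u v → u ∈ Q → v ∉ Q → u = a ∧ v = b ∨ u = b ∧ v = a := by
    intro u v huv hu hv
    refine (hcon u v huv hu hv).resolve_right ?_
    rintro (⟨rfl, rfl⟩ | ⟨rfl, rfl⟩)
    · exact h1 ⟨hu, hv⟩
    · exact h2 ⟨hu, hv⟩
  by_cases htQ : t ∈ Q
  · obtain ⟨u, v, huv, hu, -, hv, -, h⟩ :=
      hG.exists_crossing_ne_pair Q s a b ht hz htQ hts hzQ (fun h => hzQ (h ▸ hsQ))
    exact h (hall u v huv hu hv)
  · obtain ⟨u, v, huv, hu, -, hv, -, h⟩ :=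
      hG.exists_crossing_ne_pair Q z a b hs ht hsQ (fun h => hzQ (h ▸ hsQ)) htQ htz
    exact h (hall u v huv hu hv)

lemma IsSubdividing.exists_adj (h : G.IsSubdividing e x K) :
    ∃ a b, G.IsLink e a b ∧ x ∉ V(G) ∧ K.Adj x a ∧ K.Adj x b := by
  obtain ⟨a, b, e₁, e₂, hl, hx, h12, h1, h2, rfl⟩ := h
  exact ⟨a, b, hl, hx, ⟨e₁, by simp [h12]⟩, ⟨e₂, by simp⟩⟩

/-- The part of the criterion for 3-connectivity of a graph with an additional vertex `x`
that concerns cuts not containing `x`, respectively containing it. -/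
lemma IsKConnected.subdivideOne (hG : G.IsKConnected 3) (hH : V(H) = insert x V(G)) (hx : x ∉ V(G))
    (hab : a ≠ b) (hya : y ≠ a) (hyb : y ≠ b) (hxa : H.Adj x a) (hxb : H.Adj x b) (hxy : H.Adj x y)
    (ha : a ∈ V(G)) (hb : b ∈ V(G)) (hy : y ∈ V(G))
    (hadj : ∀ u v, G.Adj u v → ¬ (u = a ∧ v = b ∨ u = b ∧ v = a) → H.Adj u v) :
    H.IsKConnected 3 := by
  refine isKConnected_three_of_crossing (hG.1.trans_le (Set.encard_le_encard (by grind))) ?_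
  intro Q p q s z hp hq hpq hs hz hsQ hsp hsq hzQ hzp hzq
  by_contra! hcon
  have key : ∀ Q : Set α, ∀ s z, s ∈ V(H) → z ∈ V(H) → s ∈ Q → s ≠ p → s ≠ q → z ∉ Q → z ≠ p →
      z ≠ q → (∀ u v, H.Adj u v → u ∈ Q → u ≠ p → u ≠ q → v ∉ Q → v ≠ p → v = q) →
      x ∈ Q → False := by
    intro Q s z hs hz hsQ hsp hsq hzQ hzp hzq hcon hxQ
    -- If `x` is deleted, then `G` only loses the other deleted vertex and the edge `ab`. Otherwise
    -- one of the three neighbours `a`, `b`, `y` of `x` survives and represents the side of `x` in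
    -- `G`.
    by_cases hxpq : x = p ∨ x = q
    · obtain ⟨r, hrx, hr, hrt⟩ := exists_other hpq hxpq
      obtain ⟨u, v, huv, hu, hur, hv, hvr, h⟩ := hG.exists_crossing_ne_pair Q r a b (s := s)
        (z := z) (by grind) (by grind) hsQ (by grind) hzQ (by grind)
      have h1 := hrt u (ne_of_mem_of_not_mem huv.left_mem hx) hur
      have h2 := hrt v (ne_of_mem_of_not_mem huv.right_mem hx) hvr
      exact h2.2 (hcon u v (hadj u v huv h) hu h1.1 h1.2 hv h2.1)
    · have h1 := hcon x a hxa
      have h2 := hcon x b hxb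
      have h3 := hcon x y hxy
      have : ∃ t ∈ V(G), t ∈ Q ∧ t ≠ p ∧ t ≠ q := by
        by_cases a = p ∨ a = q
        · by_cases b = p ∨ b = q
          · exact ⟨y, by grind⟩
          · exact ⟨b, by grind⟩
        · exact ⟨a, by grind⟩
      obtain ⟨t, ht, htQ, htp, htq⟩ := this
      obtain ⟨u, v, huv, h⟩ := hG.crossing Q p q (a := t) (z := z) ht (by grind) htQ htp htq hzQ
        hzp hzq
      have := hadj u v huv
      grind
  by_cases hxQ : x ∈ Q
  · exact key Q s z hs hz hsQ hsp hsq hzQ hzp hzq hcon hxQ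
  · refine key Qᶜ z s hz hs hzQ hzp hzq (by simpa) hsp hsq ?_ hxQ
    intro u v huv hu hup huq hv hvp
    have := hcon v u huv.symm
    grind

/-- Replaces a representative of a side that may be the new vertex `y` by an old vertex: `t` lies on
the same side as `y`. -/
lemma exists_mem_of_iff {V : Set α} (P E : α → Prop) (ht : t ∈ V) (htE : E t) (hty : P t ↔ P y)
    (hs : P s) (hsE : E s) (hsV : s ≠ y → s ∈ V) : ∃ r ∈ V, P r ∧ E r := by
  by_cases h : s = y
  · exact ⟨t, ht, hty.2 (h ▸ hs), htE⟩
  · exact ⟨s, hsV h, hs, hsE⟩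

/-- The cases are how many of the new vertices `x`, `y` are deleted. If both are, only two edges are
missing from `G`; if one is, a vertex and an edge may be missing; if none is, two vertices may be,
and then the adjacent vertices `x`, `y` lie on the same side. An edge whose subdividing vertex
survives cannot cross, since its undeleted ends lie on the side of that vertex. -/
lemma IsKConnected.subdivideTwo (hG : G.IsKConnected 3) (hH : V(H) = insert x (insert y V(G)))
    (hx : x ∉ V(G)) (hy : y ∉ V(G)) (hab : a ≠ b) (hcd : c ≠ d) (hne : ({a, b} : Set α) ≠ {c, d})
    (hxa : H.Adj x a) (hxb : H.Adj x b) (hyc : H.Adj y c) (hyd : H.Adj y d) (hxy : H.Adj x y) (hxy' : x ≠ y)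
    (ha : a ∈ V(G)) (hb : b ∈ V(G)) (hc : c ∈ V(G)) (hd : d ∈ V(G))
    (hadj : ∀ u v, G.Adj u v → ¬ (u = a ∧ v = b ∨ u = b ∧ v = a) →
      ¬ (u = c ∧ v = d ∨ u = d ∧ v = c) → H.Adj u v) :
    H.IsKConnected 3 := by
  refine isKConnected_three_of_crossing (hG.1.trans_le (Set.encard_le_encard (by grind))) ?_
  intro Q p q s z hp hq hpq hs hz hsQ hsp hsq hzQ hzp hzq
  by_contra! hcon
  have hcon' : ∀ u v, H.Adj u v → u ≠ p → u ≠ q → v ≠ p → v ≠ q → (u ∈ Q ↔ v ∈ Q) := by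
    intro u v huv hup huq hvp hvq
    have := hcon u v huv
    have := hcon v u huv.symm
    grind
  have h1 := hcon' x a hxa
  have h2 := hcon' x b hxb
  have h3 := hcon' y c hyc
  have h4 := hcon' y d hyd
  have h5 := hcon' x y hxy
  have hV : ∀ w ∈ V(H), w ≠ x → w ≠ y → w ∈ V(G) := by grind
  -- There are at least three distinct ends, so one of them survives the deletion of any two
  -- vertices.
  have hab' : ∃ t, (t = a ∨ t = b) ∧ t ≠ c ∧ t ≠ d := by
    by_contra! h
    have h1 := h a (Or.inl rfl)
    have h2 := h b (Or.inr rfl)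
    apply hne
    by_cases hca : a = c
    · rw [hca, h2 (by grind)]
    · rw [h1 hca, show b = c by grind, Set.pair_comm]
  by_cases hxpq : x = p ∨ x = q
  · by_cases hypq : y = p ∨ y = q
    · have hne' : ∀ w, w ≠ p → w ≠ q → w ≠ x ∧ w ≠ y := by
        rintro w hwp hwq
        constructor
        · rintro rfl
          exact hxpq.elim hwp hwq
        · rintro rfl
          exact hypq.elim hwp hwq
      obtain ⟨u, v, huv, h⟩ := hG.exists_crossing_ne_pairs Q a b c d (s := s) (z := z)
        (hV _ hs (hne' s hsp hsq).1 (hne' s hsp hsq).2)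
        (hV _ hz (hne' z hzp hzq).1 (hne' z hzp hzq).2) hsQ hzQ
      obtain ⟨r, hrx, hr, hrt⟩ := exists_other hpq hxpq
      have hry : r = y := by
        by_contra hry
        have := hrt y hxy'.symm (Ne.symm hry)
        exact hypq.elim this.1 this.2
      have hmem : ∀ w ∈ V(G), w ≠ p ∧ w ≠ q := fun w hw => hrt w (ne_of_mem_of_not_mem hw hx)
        (hry ▸ ne_of_mem_of_not_mem hw hy)
      have h1 := hmem u huv.left_mem
      have h2 := hmem v huv.right_mem
      exact h.2.1 ((hcon' u v (hadj u v huv h.2.2.1 h.2.2.2) h1.1 h1.2 h2.1 h2.2).1 h.1)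
    · obtain ⟨r, hrx, hr, hrt⟩ := exists_other hpq hxpq
      have hyp := not_or.1 hypq
      have hcr : c ≠ r → (y ∈ Q ↔ c ∈ Q) := fun h =>
        have := hrt c (ne_of_mem_of_not_mem hc hx) h
        h3 hyp.1 hyp.2 this.1 this.2
      have hdr : d ≠ r → (y ∈ Q ↔ d ∈ Q) := fun h =>
        have := hrt d (ne_of_mem_of_not_mem hd hx) h
        h4 hyp.1 hyp.2 this.1 this.2
      obtain ⟨t, ht, htr, htQ⟩ : ∃ t ∈ V(G), t ≠ r ∧ (t ∈ Q ↔ y ∈ Q) := by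
        by_cases h : c = r
        · have h' : d ≠ r := fun h' => hcd (h.trans h'.symm)
          exact ⟨d, hd, h', (hdr h').symm⟩
        · exact ⟨c, hc, h, (hcr h).symm⟩
      have hrx' : ∀ w, w ≠ p → w ≠ q → w ≠ x ∧ w ≠ r := by
        rintro w hwp hwq
        constructor
        · rintro rfl
          exact hxpq.elim hwp hwq
        · rintro rfl
          exact hr.elim hwp hwq
      have hs' := hrx' s hsp hsq
      have hz' := hrx' z hzp hzq
      obtain ⟨s', hs', hsQ', hsr'⟩ := exists_mem_of_iff (V := V(G)) (· ∈ Q) (· ≠ r) ht htr htQ hsQ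
        hs'.2 (fun h => hV s hs hs'.1 h)
      obtain ⟨z', hz', hzQ', hzr'⟩ := exists_mem_of_iff (V := V(G)) (· ∉ Q) (· ≠ r) ht htr
        (not_congr htQ) hzQ hz'.2 (fun h => hV z hz hz'.1 h)
      obtain ⟨u, v, huv, hu, hur, hv, hvr, h⟩ :=
        hG.exists_crossing_ne_pair Q r a b hs' hz' hsQ' hsr' hzQ' hzr'
      have h1 := hrt u (ne_of_mem_of_not_mem huv.left_mem hx) hur
      have h2 := hrt v (ne_of_mem_of_not_mem huv.right_mem hx) hvr
      have h6 : ¬ (u = c ∧ v = d ∨ u = d ∧ v = c) := by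
        rintro (⟨rfl, rfl⟩ | ⟨rfl, rfl⟩)
        · exact hv ((hdr hvr).1 ((hcr hur).2 hu))
        · exact hv ((hcr hvr).1 ((hdr hur).2 hu))
      exact hv ((hcon' u v (hadj u v huv h h6) h1.1 h1.2 h2.1 h2.2).1 hu)
  · by_cases hypq : y = p ∨ y = q
    · obtain ⟨r, hrx, hr, hrt⟩ := exists_other hpq hypq
      have hyp := not_or.1 hxpq
      have hcr : a ≠ r → (x ∈ Q ↔ a ∈ Q) := fun h =>
        have := hrt a (ne_of_mem_of_not_mem ha hy) h
        h1 hyp.1 hyp.2 this.1 this.2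
      have hdr : b ≠ r → (x ∈ Q ↔ b ∈ Q) := fun h =>
        have := hrt b (ne_of_mem_of_not_mem hb hy) h
        h2 hyp.1 hyp.2 this.1 this.2
      obtain ⟨t, ht, htr, htQ⟩ : ∃ t ∈ V(G), t ≠ r ∧ (t ∈ Q ↔ x ∈ Q) := by
        by_cases h : a = r
        · have h' : b ≠ r := fun h' => hab (h.trans h'.symm)
          exact ⟨b, hb, h', (hdr h').symm⟩
        · exact ⟨a, ha, h, (hcr h).symm⟩
      have hrx' : ∀ w, w ≠ p → w ≠ q → w ≠ y ∧ w ≠ r := by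
        rintro w hwp hwq
        constructor
        · rintro rfl
          exact hypq.elim hwp hwq
        · rintro rfl
          exact hr.elim hwp hwq
      have hs' := hrx' s hsp hsq
      have hz' := hrx' z hzp hzq
      obtain ⟨s', hs', hsQ', hsr'⟩ := exists_mem_of_iff (V := V(G)) (· ∈ Q) (· ≠ r) ht htr htQ hsQ
        hs'.2 (fun h => hV s hs h hs'.1)
      obtain ⟨z', hz', hzQ', hzr'⟩ := exists_mem_of_iff (V := V(G)) (· ∉ Q) (· ≠ r) ht htr
        (not_congr htQ) hzQ hz'.2 (fun h => hV z hz h hz'.1)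
      obtain ⟨u, v, huv, hu, hur, hv, hvr, h⟩ :=
        hG.exists_crossing_ne_pair Q r c d hs' hz' hsQ' hsr' hzQ' hzr'
      have h1 := hrt u (ne_of_mem_of_not_mem huv.left_mem hy) hur
      have h2 := hrt v (ne_of_mem_of_not_mem huv.right_mem hy) hvr
      have h6 : ¬ (u = a ∧ v = b ∨ u = b ∧ v = a) := by
        rintro (⟨rfl, rfl⟩ | ⟨rfl, rfl⟩)
        · exact hv ((hdr hvr).1 ((hcr hur).2 hu))
        · exact hv ((hcr hvr).1 ((hdr hur).2 hu))
      exact hv ((hcon' u v (hadj u v huv h6 h) h1.1 h1.2 h2.1 h2.2).1 hu)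
    · have hxp := not_or.1 hxpq
      have hyp := not_or.1 hypq
      have hxy2 := h5 hxp.1 hxp.2 hyp.1 hyp.2
      have ha' : a ≠ p ∧ a ≠ q → (x ∈ Q ↔ a ∈ Q) := fun h => h1 hxp.1 hxp.2 h.1 h.2
      have hb' : b ≠ p ∧ b ≠ q → (x ∈ Q ↔ b ∈ Q) := fun h => h2 hxp.1 hxp.2 h.1 h.2
      have hc' : c ≠ p ∧ c ≠ q → (x ∈ Q ↔ c ∈ Q) := fun h =>
        hxy2.trans (h3 hyp.1 hyp.2 h.1 h.2)
      have hd' : d ≠ p ∧ d ≠ q → (x ∈ Q ↔ d ∈ Q) := fun h =>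
        hxy2.trans (h4 hyp.1 hyp.2 h.1 h.2)
      obtain ⟨t, ht, htpq, htx⟩ : ∃ t ∈ V(G), (t ≠ p ∧ t ≠ q) ∧ (t ∈ Q ↔ x ∈ Q) := by
        by_cases h : a ≠ p ∧ a ≠ q
        · exact ⟨a, ha, h, (ha' h).symm⟩
        by_cases h' : b ≠ p ∧ b ≠ q
        · exact ⟨b, hb, h', (hb' h').symm⟩
        by_cases h'' : c ≠ p ∧ c ≠ q
        · exact ⟨c, hc, h'', (hc' h'').symm⟩
        have h4 : d ≠ p ∧ d ≠ q := by
          clear hcon hcon' h1 h2 h3 h4 h5 hV ha' hb' hc' hd' hadj hxa hxb hyc hyd hxy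
          grind
        exact ⟨d, hd, h4, (hd' h4).symm⟩
      have hmem : ∀ w ∈ V(H), w ≠ x → w ∈ V(G) ∨ w = y := by
        intro w hw hwx
        by_cases hwy : w = y
        · exact Or.inr hwy
        · exact Or.inl (hV w hw hwx hwy)
      have hiff : ∀ P : α → Prop, (P t ↔ P x) → (P x ↔ P y) → ∀ w ∈ V(H), P w → (w ≠ p ∧ w ≠ q) →
          ∃ r ∈ V(G), P r ∧ (r ≠ p ∧ r ≠ q) := by
        intro P h1 h2 w hw hPw hwpq
        by_cases hwx : w = x
        · exact ⟨t, ht, h1.2 (hwx ▸ hPw), htpq⟩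
        rcases hmem w hw hwx with h | h
        · exact ⟨w, h, hPw, hwpq⟩
        · exact ⟨t, ht, h1.2 (h2.2 (h ▸ hPw)), htpq⟩
      obtain ⟨s', hs', hsQ', hsp', hsq'⟩ := hiff (· ∈ Q) htx hxy2 s hs hsQ ⟨hsp, hsq⟩
      obtain ⟨z', hz', hzQ', hzp', hzq'⟩ := hiff (· ∉ Q) (not_congr htx) (not_congr hxy2) z hz hzQ
        ⟨hzp, hzq⟩
      obtain ⟨u, v, huv, hu, hup, huq, hv, hvp, hvq⟩ :=
        hG.crossing Q p q hs' hz' hsQ' hsp' hsq' hzQ' hzp' hzq'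
      have h6 : ¬ (u = a ∧ v = b ∨ u = b ∧ v = a) := by
        rintro (⟨rfl, rfl⟩ | ⟨rfl, rfl⟩)
        · exact hv ((hb' ⟨hvp, hvq⟩).1 ((ha' ⟨hup, huq⟩).2 hu))
        · exact hv ((ha' ⟨hvp, hvq⟩).1 ((hb' ⟨hup, huq⟩).2 hu))
      have h7 : ¬ (u = c ∧ v = d ∨ u = d ∧ v = c) := by
        rintro (⟨rfl, rfl⟩ | ⟨rfl, rfl⟩)
        · exact hv ((hd' ⟨hvp, hvq⟩).1 ((hc' ⟨hup, huq⟩).2 hu))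
        · exact hv ((hc' ⟨hvp, hvq⟩).1 ((hd' ⟨hup, huq⟩).2 hu))
      exact hv ((hcon' u v (hadj u v huv h6 h7) hup huq hvp hvq).1 hu)

lemma IsBGOp.isKConnected (hL : G.Loopless) (h : G.IsBGOp g H) : H.IsKConnected 3 := by
  cases h with
  | add x y h3 hx hy hxy hg =>
    refine isKConnected_three_of_crossing (h3.1.trans_le (Set.encard_le_encard (by simp; grind))) ?_
    intro Q p q s z hp hq hpq hs hz hsQ hsp hsq hzQ hzp hzq
    obtain ⟨c, d, hcd, h⟩ := h3.crossing Q p q (a := s) (z := z) (by simp at hs; grind)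
      (by simp at hz; grind) hsQ hsp hsq hzQ hzp hzq
    exact ⟨c, d, (addEdge_adj_of_notMem hg).2 (Or.inl hcd), h⟩
  | subdivideOne e x y K h3 hK hy hye hg =>
    obtain ⟨a, b, hl, hx, hxa, hxb⟩ := hK.exists_adj
    have hVK := hK.vertexSet_eq
    have hya : y ≠ a := by rintro rfl; exact hye hl.inc_left
    have hyb : y ≠ b := by rintro rfl; exact hye hl.inc_right
    refine h3.subdivideOne (x := x) (a := a) (b := b) (y := y) (by simp; grind) hx hl.ne hya hyb ?_
      ?_ ?_ hl.left_mem hl.right_mem hy ?_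
    · exact (addEdge_adj_of_notMem hg).2 (Or.inl hxa)
    · exact (addEdge_adj_of_notMem hg).2 (Or.inl hxb)
    · exact (addEdge_adj_of_notMem hg).2 (Or.inr (by simp))
    · rintro u v ⟨e', huv⟩ hne
      refine (addEdge_adj_of_notMem hg).2 (Or.inl ⟨e', hK.isLink_of_ne huv ?_⟩)
      rintro rfl
      exact hne (huv.eq_and_eq_or_eq_and_eq hl)
  | subdivideTwo e f x y K L h3 he hf hef hpar hK hL' hg =>
    obtain ⟨a, b, hl, hx, hxa, hxb⟩ := hK.exists_adj
    obtain ⟨c, d, hl', hy, hyc, hyd⟩ := hL'.exists_adj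
    have hVK := hK.vertexSet_eq
    have hVL := hL'.vertexSet_eq
    -- The edge `f` is an edge of `G` other than `e`, so the first subdivision left its ends alone.
    have hflink : G.IsLink f c d := by
      obtain ⟨u, v, huv⟩ := exists_isLink_of_mem_edgeSet hf
      rcases (hK.isLink_of_ne huv hef.symm).eq_and_eq_or_eq_and_eq hl' with ⟨rfl, rfl⟩ | ⟨rfl, rfl⟩
      · exact huv
      · exact huv.symm
    have hx' : ∀ w, K.Adj x w → L.Adj x w := by
      rintro w ⟨e', he'⟩
      refine ⟨e', hL'.isLink_of_ne he' ?_⟩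
      rintro rfl
      have h1 := hflink.left_mem
      have h2 := hflink.right_mem
      have := he'.left_eq_or_eq hl'
      grind
    refine h3.subdivideTwo (x := x) (a := a) (b := b) (y := y) (c := c) (d := d) (by simp; grind) hx
      (by grind) hl.ne hflink.ne ?_ ?_ ?_ ?_ ?_ ?_ ?_ hl.left_mem hl.right_mem hflink.left_mem
      hflink.right_mem ?_
    · intro hset
      apply hpar
      refine ⟨a, b, hl, ?_⟩
      have : c = a ∧ d = b ∨ c = b ∧ d = a := by
        have := hflink.ne
        have : c ∈ ({a, b} : Set α) := by rw [hset]; simp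
        have : d ∈ ({a, b} : Set α) := by rw [hset]; simp
        grind
      rcases this with ⟨rfl, rfl⟩ | ⟨rfl, rfl⟩
      · exact hflink
      · exact hflink.symm
    · exact (addEdge_adj_of_notMem hg).2 (Or.inl (hx' _ hxa))
    · exact (addEdge_adj_of_notMem hg).2 (Or.inl (hx' _ hxb))
    · exact (addEdge_adj_of_notMem hg).2 (Or.inl hyc)
    · exact (addEdge_adj_of_notMem hg).2 (Or.inl hyd)
    · exact (addEdge_adj_of_notMem hg).2 (Or.inr (by simp))
    · grind
    · rintro u v ⟨e', huv⟩ hne hne'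
      have h1 : e' ≠ e := by
        rintro rfl
        exact hne (huv.eq_and_eq_or_eq_and_eq hl)
      have h2 : e' ≠ f := by
        rintro rfl
        exact hne' (huv.eq_and_eq_or_eq_and_eq hflink)
      exact (addEdge_adj_of_notMem hg).2 (Or.inl ⟨e', hL'.isLink_of_ne (hK.isLink_of_ne huv h1) h2⟩)

lemma IsBGOp.loopless (hL : G.Loopless) (h : G.IsBGOp g H) : H.Loopless := by
  cases h with
  | add x y h3 hx hy hxy hg => exact Loopless.addEdge hL hxy
  | subdivideOne e x y K h3 hK hy hye hg =>
    obtain ⟨a, b, hl, hx, -⟩ := hK.exists_adj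
    exact Loopless.addEdge (hK.loopless hL) (by grind)
  | subdivideTwo e f x y K L h3 he hf hef hpar hK hL' hg =>
    obtain ⟨c, d, hl', hy, -⟩ := hL'.exists_adj
    have := hK.mem_vertexSet
    exact Loopless.addEdge (hL'.loopless (hK.loopless hL)) (by grind)

end Preservation

end Graph

namespace SimpleGraph

/-! ### A simple 3-connected graph on at least five vertices has an unobstructed edge. -/

section Removable

variable {W : Type*} {G : SimpleGraph W} {A B A' B' : Set W} {p q s t u v w x y z : W}

/-- Any set of vertices that is neither empty nor everything after deleting `p` and `q`
is left by an edge avoiding `p` and `q`. -/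
def IsThreeLinked (G : SimpleGraph W) : Prop :=
  ∀ (Q : Set W) (p q a z : W), a ∈ Q → a ≠ p → a ≠ q → z ∉ Q → z ≠ p → z ≠ q →
    ∃ c d, G.Adj c d ∧ c ∈ Q ∧ c ≠ p ∧ c ≠ q ∧ d ∉ Q ∧ d ≠ p ∧ d ≠ q

/-- Deleting the edge `xy` and the vertices `u`, `v` separates `A`, which contains `x` and
another vertex, from `B`, which contains `y` and another vertex. -/
structure IsFatSep (G : SimpleGraph W) (x y : W) (A B : Set W) (u v : W) : Prop where
  left_mem : x ∈ A
  right_mem : y ∈ B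
  fst_notMem_left : u ∉ A
  fst_notMem_right : u ∉ B
  snd_notMem_left : v ∉ A
  snd_notMem_right : v ∉ B
  disj : ∀ a ∈ A, a ∉ B
  cover : ∀ w, w ∈ A ∨ w ∈ B ∨ w = u ∨ w = v
  eq_of_adj : ∀ a ∈ A, ∀ b ∈ B, G.Adj a b → a = x ∧ b = y
  exists_left : ∃ a ∈ A, a ≠ x
  exists_right : ∃ b ∈ B, b ≠ y

/-- `x` has degree three, and its two neighbours other than `y` are adjacent. -/
def IsTri (G : SimpleGraph W) (x y : W) : Prop :=
  ∃ p q, p ≠ q ∧ p ≠ y ∧ q ≠ y ∧ G.Adj p q ∧ ∀ w, G.Adj x w ↔ w = y ∨ w = p ∨ w = q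

/-- Removing the edge `xy` does not leave a simple 3-connected graph. -/
def IsObstructed (G : SimpleGraph W) (x y : W) : Prop :=
  (∃ A B u v, G.IsFatSep x y A B u v) ∨ G.IsTri x y ∨ G.IsTri y x

lemma IsFatSep.symm (h : G.IsFatSep x y A B u v) : G.IsFatSep y x B A u v where
  left_mem := h.right_mem
  right_mem := h.left_mem
  fst_notMem_left := h.fst_notMem_right
  fst_notMem_right := h.fst_notMem_left
  snd_notMem_left := h.snd_notMem_right
  snd_notMem_right := h.snd_notMem_left
  disj a ha hb := h.disj a hb ha
  cover w := by have := h.cover w; tauto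
  eq_of_adj a ha b hb hab := (h.eq_of_adj b hb a ha hab.symm).symm
  exists_left := h.exists_right
  exists_right := h.exists_left

lemma IsFatSep.swap (h : G.IsFatSep x y A B u v) : G.IsFatSep x y A B v u where
  left_mem := h.left_mem
  right_mem := h.right_mem
  fst_notMem_left := h.snd_notMem_left
  fst_notMem_right := h.snd_notMem_right
  snd_notMem_left := h.fst_notMem_left
  snd_notMem_right := h.fst_notMem_right
  disj := h.disj
  cover w := by have := h.cover w; tauto
  eq_of_adj := h.eq_of_adj
  exists_left := h.exists_left
  exists_right := h.exists_right

lemma IsThreeLinked.exists_adj (hc : G.IsThreeLinked) (h5 : ∀ a b c d : W, ∃ z, z ≠ a ∧ z ≠ b ∧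
    z ≠ c ∧ z ≠ d) (x p q : W) : ∃ z, G.Adj x z ∧ z ≠ p ∧ z ≠ q := by
  obtain ⟨t, ht⟩ := h5 x p q q
  by_cases hxp : x = p
  · by_cases hxq : x = q
    · obtain ⟨t', ht'⟩ := h5 x t t t
      obtain ⟨c, d, h⟩ := hc {x} t' t' x t (by simp) (by grind) (by grind) (by grind) (by grind)
        (by grind)
      exact ⟨d, by grind⟩
    · obtain ⟨c, d, h⟩ := hc {x} q q x t (by simp) (by grind) (by grind) (by grind) (by grind)
        (by grind)
      exact ⟨d, by grind⟩
  · by_cases hxq : x = q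
    · obtain ⟨c, d, h⟩ := hc {x} p p x t (by simp) (by grind) (by grind) (by grind) (by grind)
        (by grind)
      exact ⟨d, by grind⟩
    · obtain ⟨c, d, h⟩ := hc {x} p q x t (by simp) (by grind) (by grind) (by grind) (by grind)
        (by grind)
      exact ⟨d, by grind⟩

/-- If `x` has degree three and its neighbours include adjacent `p`, `q`, where `w`, `x`, `p`, `q`
are pairwise adjacent, then the edge `pq` is not obstructed. -/
lemma IsThreeLinked.not_isObstructed_of_clique (hc : G.IsThreeLinked)
    (h5 : ∀ a b c d : W, ∃ z, z ≠ a ∧ z ≠ b ∧ z ≠ c ∧ z ≠ d)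
    (hw : ∀ z, G.Adj w z ↔ z = x ∨ z = p ∨ z = q) (hxp : G.Adj x p) (hxq : G.Adj x q)
    (hpq : G.Adj p q) : ¬ G.IsObstructed p q := by
  have hwx : G.Adj w x := (hw x).2 (by simp)
  have hwp : G.Adj w p := (hw p).2 (by simp)
  have hwq : G.Adj w q := (hw q).2 (by simp)
  have tri : ∀ p q, (∀ z, G.Adj w z ↔ z = x ∨ z = p ∨ z = q) → G.Adj x p → G.Adj x q →
      G.Adj w p → G.Adj w q → G.Adj p q → ¬ G.IsTri p q := by
    rintro p q hw hxp hxq hwp hwq hpq ⟨r, s, hrs, hrq, hsq, hadj, hp⟩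
    obtain ⟨z, hz⟩ := h5 w x p q
    have hpw := (hp w).1 hwp.symm
    have hpx := (hp x).1 hxp.symm
    obtain ⟨c, d, hcd, h1, h2, h3, h4⟩ := hc {w, p} x q w z (by simp) hwx.ne hwq.ne (by grind)
      (by grind) (by grind)
    have := hwx.ne
    have := hwq.ne
    have := hxq.ne
    have h5 := hw d
    have h6 := hp d
    grind
  rintro (⟨A, B, u, v, h⟩ | h | h)
  -- Every common neighbour of `p` and `q` lies in the separator, so the separator consists of `w`
  -- and `x`. Once `p` and `x` are deleted, `A` could be left through `w` only, but `w` has no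
  -- further neighbour in `A`.
  · have hS : ∀ z, G.Adj z p → G.Adj z q → z = u ∨ z = v := by
      intro z hzp hzq
      have h1 := h.eq_of_adj z
      have h2 := h.eq_of_adj p h.left_mem z
      have := h.cover z
      have := h.right_mem
      have := hzp.ne
      have := hzq.ne
      have := hzp.symm
      grind
    have h1 := hS w hwp hwq
    have h2 := hS x hxp hxq
    have h3 : w ≠ x := hwx.ne
    have h4 : w ∉ A := by rcases h1 with rfl | rfl; exacts [h.fst_notMem_left, h.snd_notMem_left]
    have h5 : x ∉ A := by rcases h2 with rfl | rfl; exacts [h.fst_notMem_left, h.snd_notMem_left]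
    obtain ⟨a, ha, hap⟩ := h.exists_left
    obtain ⟨c, d, hcd, hcA, hcp, hcx, hdA, hdp, hdx⟩ := hc A p x a q ha hap
      (fun h => h5 (h ▸ ha)) (fun h' => h.disj q h' h.right_mem) hpq.ne.symm hxq.ne.symm
    have h6 := h.cover d
    have h7 := h.eq_of_adj c hcA d
    have h8 := (hw c)
    have h9 := hcd.symm
    have h10 := h.disj q
    have h11 := h.right_mem
    grind
  · exact tri p q hw hxp hxq hwp hwq hpq h
  · exact tri q p (by grind) hxq hxp hwq hwp hpq.symm h

/-- Otherwise `wp` and `wq` are both obstructed by triangles. Either `w`, `x`, `p`, `q` form a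
clique and `pq` is unobstructed, or `p` and `q` have degree three with a common third neighbour `r`,
and then `x` and `r` separate `{w, p, q}` from the rest. -/
lemma IsThreeLinked.isFatSep_of_isTri (hc : G.IsThreeLinked)
    (h5 : ∀ a b c d : W, ∃ z, z ≠ a ∧ z ≠ b ∧ z ≠ c ∧ z ≠ d)
    (hbad : ∀ x y, G.Adj x y → G.IsObstructed x y)
    (hw : ∀ z, G.Adj w z ↔ z = x ∨ z = p ∨ z = q) (hpq : G.Adj p q) (hxp : x ≠ p) (hxq : x ≠ q) :
    (∃ A B u v, G.IsFatSep w p A B u v) ∨ (∃ A B u v, G.IsFatSep w q A B u v) := by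
  by_contra! hno
  have hwx : G.Adj w x := (hw x).2 (by simp)
  have hwp : G.Adj w p := (hw p).2 (by simp)
  have hwq : G.Adj w q := (hw q).2 (by simp)
  have hw' : ∀ p q, (∀ z, G.Adj w z ↔ z = x ∨ z = p ∨ z = q) → G.Adj p q → x ≠ p → x ≠ q →
      G.Adj w p → G.Adj w q → (¬ ∃ A B u v, G.IsFatSep w p A B u v) →
      G.Adj x q ∨ ∃ r, r ≠ w ∧ r ≠ q ∧ r ≠ p ∧ G.Adj q r ∧ ∀ z, G.Adj p z ↔ z = w ∨ z = q ∨ z = r := by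
    intro p q hw hpq hxp hxq hwp hwq hno
    rcases hbad w p hwp with h | ⟨r, s, hrs, hrp, hsp, hadj, h⟩ | ⟨r, s, hrs, hrw, hsw, hadj, h⟩
    · exact absurd h hno
    · have h1 := (hw r).1 ((h r).2 (by simp))
      have h2 := (hw s).1 ((h s).2 (by simp))
      have := hadj.symm
      grind
    · right
      have h1 := (h q).1 hpq
      have h2 := hwq.ne
      have h3 := hadj.symm
      have h4 := (h r).2 (by simp)
      have h6 := h4.ne
      have h5 := (h s).2 (by simp)
      have h7 := h5.ne
      rcases h1 with rfl | rfl | rfl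
      · exact absurd rfl h2
      · exact ⟨s, by grind⟩
      · exact ⟨r, by grind⟩
  have h1 := hw' p q hw hpq hxp hxq hwp hwq (by push Not; exact hno.1)
  have h2 := hw' q p (by grind) hpq.symm hxq hxp hwq hwp (by push Not; exact hno.2)
  have hcl : ¬ (G.Adj x p ∧ G.Adj x q) := fun h =>
    hc.not_isObstructed_of_clique h5 hw h.1 h.2 hpq (hbad p q hpq)
  rcases h1 with h1 | ⟨r, hrw, hrq, hrp, hqr, hp⟩
  · rcases h2 with h2 | ⟨r, hrw, hrp, hrq, hpr, hq⟩
    · exact hcl ⟨h2, h1⟩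
    · have h3 := (hq x).1 h1.symm
      obtain rfl := (h3.resolve_left hwx.ne.symm).resolve_left hxp
      exact hcl ⟨hpr.symm, h1⟩
  · rcases h2 with h2 | ⟨r', hrw', hrp', hrq', hpr', hq⟩
    · have h3 := (hp x).1 h2.symm
      obtain rfl := (h3.resolve_left hwx.ne.symm).resolve_left hxq
      exact hcl ⟨h2, hqr.symm⟩
    · have hrr : r = r' := by
        have := (hq r).1 hqr
        grind
      subst hrr
      have hxr : x ≠ r := by
        rintro rfl
        exact hcl ⟨((hp x).2 (by simp)).symm, hqr.symm⟩
      obtain ⟨z, hz⟩ := h5 w p q x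
      by_cases hzr : z = r
      -- If `w`, `p`, `q`, `x`, `r` are all the vertices, nothing remains to be separated; but then
      -- `x` lacks a third neighbour.
      · by_cases hex : ∃ z, z ≠ w ∧ z ≠ p ∧ z ≠ q ∧ z ≠ x ∧ z ≠ r
        · obtain ⟨z, hz⟩ := hex
          obtain ⟨c, d, h⟩ := hc {w, p, q} x r w z (by simp) hwx.ne hrw.symm (by grind) (by grind)
            (by grind)
          have h3 := hw d
          have h4 := hp d
          have h5 := hq d
          grind
        · obtain ⟨z, hxz, hzw, hzr⟩ := hc.exists_adj h5 x w r
          have : z = p ∨ z = q := by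
            by_contra! h
            exact hex ⟨z, hzw, h.1, h.2, hxz.ne.symm, hzr⟩
          rcases this with rfl | rfl
          · exact ((hp x).1 hxz.symm).elim hwx.ne.symm (fun h => h.elim hxq hxr)
          · exact ((hq x).1 hxz.symm).elim hwx.ne.symm (fun h => h.elim hxp hxr)
      · obtain ⟨c, d, h⟩ := hc {w, p, q} x r w z (by simp) hwx.ne hrw.symm (by grind) (by grind)
            (by grind)
        have h3 := hw d
        have h4 := hp d
        have h5 := hq d
        grind

/-- The part of a fat separation containing `x` is attached at both other vertices `u`, `v` of the
separation, and so is the other part. -/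
lemma IsFatSep.exists_adj (hc : G.IsThreeLinked) (h : G.IsFatSep x y A B u v) :
    ∃ b ∈ B, G.Adj v b := by
  obtain ⟨b, hb, hby⟩ := h.exists_right
  obtain ⟨c, d, hcd, hcB, hcy, hcu, hdB, hdy, hdu⟩ := hc B y u b x hb hby
    (fun h' => h.fst_notMem_right (h' ▸ hb)) (h.disj x h.left_mem)
    (fun h' => h.disj x h.left_mem (h' ▸ h.right_mem)) (fun h' => h.fst_notMem_left (h' ▸ h.left_mem))
  have h1 := h.cover d
  have h2 := h.eq_of_adj d
  have h3 := hcd.symm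
  have : d = v := by grind
  exact ⟨c, hcB, this ▸ h3⟩

/-- The rest of `A` is nonempty, and after deleting `u` and `v` it can be left only towards `x`. -/
lemma IsFatSep.exists_adj_left (hc : G.IsThreeLinked) (h : G.IsFatSep x y A B u v) :
    ∃ w ∈ A, G.Adj x w := by
  obtain ⟨a, ha, hax⟩ := h.exists_left
  obtain ⟨c, d, hcd, hcA, hcu, hcv, hdA, hdu, hdv⟩ := hc (A \ {x}) u v a y ⟨ha, by simpa⟩
    (fun h' => h.fst_notMem_left (h' ▸ ha)) (fun h' => h.snd_notMem_left (h' ▸ ha))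
    (fun h' => h.disj y h'.1 h.right_mem)
    (fun h' => h.fst_notMem_right (h' ▸ h.right_mem))
    (fun h' => h.snd_notMem_right (h' ▸ h.right_mem))
  have h1 := h.cover d
  have h2 := h.eq_of_adj c hcA.1 d
  have h3 := hcd.symm
  have h4 : c ≠ x := hcA.2
  have : d = x := by grind
  exact ⟨c, hcA.1, this ▸ h3⟩

/-- If `w` is the only neighbour of `x` in `A`, then `x` can be moved to the other side. -/
lemma IsFatSep.shift (h : G.IsFatSep x y A B u v) (hw : w ∈ A) (hxw : G.Adj x w)
    (huniq : ∀ z ∈ A, G.Adj x z → z = w) (hex : ∃ a ∈ A, a ≠ x ∧ a ≠ w) :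
    G.IsFatSep w x (A \ {x}) (insert x B) u v := by
  have hwx := hxw.ne
  have hl := h.left_mem
  have hr := h.right_mem
  refine ⟨by grind, by grind, by grind [h.fst_notMem_left], by grind [h.fst_notMem_right,
    h.fst_notMem_left], by grind [h.snd_notMem_left], by grind [h.snd_notMem_right,
    h.snd_notMem_left], by grind [h.disj], ?_, ?_, ?_, ⟨y, by grind, by grind [h.disj]⟩⟩
  · intro z
    have := h.cover z
    grind
  · intro a ha b hb hab
    have h1 := h.eq_of_adj a ha.1 b
    have h2 := huniq a ha.1
    have h3 : a ≠ x := ha.2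
    have := hab.symm
    grind
  · obtain ⟨a, ha, hax, haw⟩ := hex
    exact ⟨a, ⟨ha, hax⟩, haw⟩

/-- If `A = {x, w}`, where `x` has degree three and is adjacent to `v`, then the edge `xv` is not
obstructed. -/
lemma IsFatSep.not_isObstructed (hc : G.IsThreeLinked)
    (h5 : ∀ a b c d : W, ∃ z, z ≠ a ∧ z ≠ b ∧ z ≠ c ∧ z ≠ d) (h : G.IsFatSep x y A B u v)
    (hA : ∀ a ∈ A, a = x ∨ a = w) (hx : ∀ z, G.Adj x z ↔ z = w ∨ z = y ∨ z = v)
    (hw : w ∈ A) : ¬ G.IsObstructed x v := by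
  have hxw : G.Adj x w := (hx w).2 (by simp)
  have hxy : G.Adj x y := (hx y).2 (by simp)
  have hxv : G.Adj x v := (hx v).2 (by simp)
  have hxA := h.left_mem
  have hyB := h.right_mem
  have hdis := h.disj
  have hu1 := h.fst_notMem_left
  have hu2 := h.fst_notMem_right
  have hv1 := h.snd_notMem_left
  have hv2 := h.snd_notMem_right
  have hwsub : ∀ z, G.Adj w z → z = x ∨ z = u ∨ z = v := by
    intro z hz
    have h1 := h.cover z
    have h2 := h.eq_of_adj w hw z
    have h3 := hA z
    have h4 := hz.ne
    have h5 := hxw.ne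
    grind
  -- A vertex has at least three neighbours, so the three candidates all occur.
  have hwall : ∀ z, G.Adj w z ↔ z = x ∨ z = u ∨ z = v := by
    intro z
    refine ⟨hwsub z, ?_⟩
    obtain ⟨a, ha, hau, hav⟩ := hc.exists_adj h5 w u v
    obtain ⟨b, hb, hbx, hbu⟩ := hc.exists_adj h5 w x u
    obtain ⟨d, hd, hdx, hdv⟩ := hc.exists_adj h5 w x v
    have h1 := hwsub a ha
    have h2 := hwsub b hb
    have h3 := hwsub d hd
    grind
  have hwu : G.Adj w u := (hwall u).2 (by simp)
  have hwv : G.Adj w v := (hwall v).2 (by simp)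
  have huv : u ≠ v := by
    rintro rfl
    obtain ⟨d, hd, hdx, hdv⟩ := hc.exists_adj h5 w x u
    have := hwsub d hd
    grind
  have hxu : ¬ G.Adj x u := by
    rw [hx]
    grind
  have hyv : y ≠ v := fun h => hv2 (h ▸ hyB)
  have hyw : ¬ G.Adj w y := by
    rw [hwall]
    grind
  rintro (⟨A', B', p, q, h'⟩ | ⟨r, s, hrs, hrv, hsv, hadj, hN⟩ | ⟨r, s, hrs, hrx, hsx, hadj, hN⟩)
  -- The common neighbour `w` of `x` and `v` lies in the separator of any fat separation for `xv`.
  -- In each case below a vertex can be dropped from the cut, or `x` with its few neighbours can be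
  -- cut off, against 3-connectivity.
  · have key : ∀ q, G.IsFatSep x v A' B' w q → False := by
      clear h' q
      intro q h'
      have hxA' := h'.left_mem
      have hvB' := h'.right_mem
      have hq1 := h'.snd_notMem_left
      have hq2 := h'.snd_notMem_right
      have hw1 := h'.fst_notMem_left
      have hw2 := h'.fst_notMem_right
      obtain ⟨a, ha, hax⟩ := h'.exists_left
      obtain ⟨b, hb, hbv⟩ := h'.exists_right
      have hyA' : y ∈ A' ∨ y = q := by
        have h1 := h'.cover y
        have h2 := h'.eq_of_adj x hxA' y
        have h3 := hxy
        grind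
      have hvA' : v ∉ A' := fun h => h'.disj v h hvB'
      rcases hyA' with hyA' | rfl
      · by_cases huA' : u ∈ A' ∨ u = q
        · obtain ⟨c, d, hcd, hcB, hcv, hcq, hdB, hdv, hdq⟩ := hc B' v q b x hb hbv
            (fun h => hq2 (h ▸ hb)) (h'.disj x hxA') hxv.ne (fun h => hq1 (h ▸ hxA'))
          have h1 := h'.cover d
          have h2 := h'.eq_of_adj d
          have h3 := (hwall c)
          have h4 := hcd.symm
          have h6 := h'.disj x
          have h7 := h'.disj u
          grind
        · obtain ⟨c, d, hcd, hcA, hcx, hcq, hdA, hdx, hdq⟩ := hc A' x q y u hyA'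
            (by grind) (fun h => hq1 (h ▸ hyA')) (by grind) (by grind) (by grind)
          have h1 := h'.cover d
          have h2 := h'.eq_of_adj c hcA d
          have h3 := (hwall c)
          have h4 := hcd.symm
          grind
      · obtain ⟨c, d, hcd, hcA, hcw, hcy, hdA, hdw, hdy⟩ := hc (A' \ {x}) w y a x ⟨ha, hax⟩
          (fun h => hw1 (h ▸ ha)) (fun h => hq1 (h ▸ ha)) (fun h => h.2 rfl) hxw.ne hxy.ne
        have h1 := h'.cover d
        have h2 := h'.eq_of_adj c hcA.1 d
        have h3 : c ≠ x := hcA.2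
        have h4 := hx c
        have h6 := hcA.1
        have h7 := hcd.symm
        grind
    have hS : w = p ∨ w = q := by
      have h1 := h'.cover w
      have h2 := h'.eq_of_adj x h'.left_mem w
      have h3 := h'.eq_of_adj w
      have h4 := h'.right_mem
      have h5 := hxw.ne
      have h6 := hwv.ne
      grind
    rcases hS with rfl | rfl
    · exact key q h'
    · exact key p h'.swap
  · have h1 := (hx r).1 ((hN r).2 (by simp))
    have h2 := (hx s).1 ((hN s).2 (by simp))
    have h3 := hadj.symm
    grind
  · obtain ⟨b, hb, hvb⟩ := h.exists_adj hc
    have h1 := (hN w).1 hwv.symm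
    have h2 := (hN b).1 hvb
    have h3 := hwall b
    have h4 := hadj.symm
    have h5 := hxw.ne
    grind

/-! ### Uncrossing a fat separation for `xy` with one for `xw`, where `w ∈ A`. -/

lemma IsFatSep.adj (hc : G.IsThreeLinked) (h : G.IsFatSep x y A B u v) : G.Adj x y := by
  have hx := h.left_mem
  have hy := h.right_mem
  obtain ⟨c, d, hcd, hcA, hcu, hcv, hdA, hdu, hdv⟩ := hc A u v x y hx
    (fun h' => h.fst_notMem_left (h' ▸ hx)) (fun h' => h.snd_notMem_left (h' ▸ hx))
    (fun h' => h.disj y h' hy) (fun h' => h.fst_notMem_right (h' ▸ hy))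
    (fun h' => h.snd_notMem_right (h' ▸ hy))
  have h1 := (h.cover d).resolve_left hdA
  have h2 := h.eq_of_adj c hcA d (h1.resolve_right (by tauto)) hcd
  exact h2.1 ▸ h2.2 ▸ hcd

lemma IsFatSep.of_adj_left (h : G.IsFatSep x y A B u v) (ht : t ∈ A) (hts : G.Adj t s) :
    s ∈ A ∨ s = u ∨ s = v ∨ (t = x ∧ s = y) := by
  have h1 := h.cover s
  have h2 := h.eq_of_adj t ht s
  tauto

lemma IsFatSep.of_adj_right (h : G.IsFatSep x y A B u v) (ht : t ∈ B) (hts : G.Adj t s) :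
    s ∈ B ∨ s = u ∨ s = v ∨ (t = y ∧ s = x) :=
  h.symm.of_adj_left ht hts

/-- A corner argument: neither exceptional edge leaves `B ∩ B'`, since `y ∉ B'` and `w ∉ B`. So if
this corner can be left only towards `r` and `s`, these two would separate the rest of it from `x`.
In this and the next lemmas `hcl` states where the corner can be left when the exceptional edges are
ignored. -/
lemma IsFatSep.right_inter_right (hc : G.IsThreeLinked) (h : G.IsFatSep x y A B u v) (hw : w ∈ A)
    (h' : G.IsFatSep x w A' B' p q)
    (hy : y ∉ B') (r s : W) (hr : x ≠ r) (hs : x ≠ s)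
    (hcl : ∀ d, d = u ∨ d = v ∨ d ∈ B → d = p ∨ d = q ∨ d ∈ B' → d ∈ B ∧ d ∈ B' ∨ d = r ∨ d = s) :
    ∀ b ∈ B, b ∈ B' → b = r ∨ b = s := by
  intro b hb hb'
  by_contra! hcon
  obtain ⟨c, d, hcd, hcQ, hcr, hcs, hdQ, hdr, hds⟩ := hc (B ∩ B') r s b x ⟨hb, hb'⟩ hcon.1 hcon.2
    (fun h1 => h.disj x h.left_mem h1.1) hr hs
  have h1 := h.of_adj_right hcQ.1 hcd
  have h2 := h'.of_adj_right hcQ.2 hcd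
  have h3 : c ≠ y := fun h3 => hy (h3 ▸ hcQ.2)
  have h4 : c ≠ w := fun h4 => h.disj w hw (h4 ▸ hcQ.1)
  have h5 := hcl d (by tauto) (by tauto)
  exact (h5.resolve_left hdQ).elim hdr hds

/-- The edge `yx` may leave the corner `B ∩ A'`; then `x` has to be one of the two separating
vertices. -/
lemma IsFatSep.right_inter_left (hc : G.IsThreeLinked) (h : G.IsFatSep x y A B u v) (hw : w ∈ A)
    (h' : G.IsFatSep x w A' B' p q)
    (r s : W) (hr : w ≠ r) (hs : w ≠ s)
    (hxy : y ∈ A' → x = r ∨ x = s)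
    (hcl : ∀ d, d = u ∨ d = v ∨ d ∈ B → d = p ∨ d = q ∨ d ∈ A' → d ∈ B ∧ d ∈ A' ∨ d = r ∨ d = s) :
    ∀ b ∈ B, b ∈ A' → b = r ∨ b = s := by
  intro b hb hb'
  by_contra! hcon
  obtain ⟨c, d, hcd, hcQ, hcr, hcs, hdQ, hdr, hds⟩ := hc (B ∩ A') r s b w ⟨hb, hb'⟩ hcon.1 hcon.2
    (fun h1 => h.disj w hw h1.1) hr hs
  have h1 := h.of_adj_right hcQ.1 hcd
  have h2 := h'.of_adj_left hcQ.2 hcd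
  have h3 : c = y → d ≠ x := by
    rintro rfl rfl
    exact (hxy hcQ.2).elim hdr hds
  have h4 : c ≠ x := fun h4 => h.disj x h.left_mem (h4 ▸ hcQ.1)
  have h5 := hcl d (by tauto) (by tauto)
  exact (h5.resolve_left hdQ).elim hdr hds

/-- The corner `A ∩ B'` contains `w` but not `y`, so `x` and `r` cannot be its only exits. -/
lemma IsFatSep.not_left_inter_right (hc : G.IsThreeLinked) (h : G.IsFatSep x y A B u v) (hw : w ∈ A)
    (h' : G.IsFatSep x w A' B' p q)
    (r : W) (hr : y ≠ r) (hwr : w ≠ r)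
    (hcl : ∀ d, d = u ∨ d = v ∨ d ∈ A → d = p ∨ d = q ∨ d ∈ B' → d ∈ A ∧ d ∈ B' ∨ d = r ∨ d = x) :
    False := by
  have hxw : w ≠ x := fun h1 => h'.disj x h'.left_mem (h1 ▸ h'.right_mem)
  have hyx : y ≠ x := fun h1 => h.disj x h.left_mem (h1 ▸ h.right_mem)
  obtain ⟨c, d, hcd, hcQ, hcr, hcs, hdQ, hdr, hds⟩ := hc (A ∩ B') r x w y ⟨hw, h'.right_mem⟩ hwr hxw
    (fun h1 => h.disj y h1.1 h.right_mem) hr hyx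
  have h1 := h.of_adj_left hcQ.1 hcd
  have h2 := h'.of_adj_right hcQ.2 hcd
  have h5 := hcl d (by tauto) (by tauto)
  exact (h5.resolve_left hdQ).elim hdr hds

/-- Both exceptional edges leave the corner `A ∩ A'` at `x`; so if `r` is the only other exit, `x`
and `r` would separate the rest of the corner from `w`. -/
lemma IsFatSep.left_inter_left (hc : G.IsThreeLinked) (h : G.IsFatSep x y A B u v)
    (h' : G.IsFatSep x w A' B' p q) (r : W) (hr : w ≠ r)
    (hcl : ∀ d, d = u ∨ d = v ∨ d ∈ A → d = p ∨ d = q ∨ d ∈ A' → d ∈ A ∧ d ∈ A' ∨ d = r) :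
    ∀ a ∈ A, a ∈ A' → a = x ∨ a = r := by
  intro b hb hb'
  by_contra! hcon
  have hxw : w ≠ x := fun h1 => h'.disj x h'.left_mem (h1 ▸ h'.right_mem)
  obtain ⟨c, d, hcd, hcQ, hcr, hcs, hdQ, hdr, hds⟩ := hc (A ∩ A') x r b w ⟨hb, hb'⟩ hcon.1 hcon.2
    (fun h1 => h'.disj w h1.2 h'.right_mem) hxw hr
  have h1 := h.of_adj_left hcQ.1 hcd
  have h2 := h'.of_adj_left hcQ.2 hcd
  have h5 := hcl d (by tauto) (by tauto)
  exact hds (h5.resolve_left hdQ)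

lemma IsFatSep.of_adj_of_left_inter_left (hc : G.IsThreeLinked) (h : G.IsFatSep x y A B u v)
    (h' : G.IsFatSep x w A' B' p q) (r : W) (hr : w ≠ r)
    (hcl : ∀ d, d = u ∨ d = v ∨ d ∈ A → d = p ∨ d = q ∨ d ∈ A' → d ∈ A ∧ d ∈ A' ∨ d = r) :
    ∀ z, G.Adj x z → z = w ∨ z = y ∨ z = r := by
  intro z hz
  have h0 := h.left_inter_left hc h' r hr hcl
  have h1 := h.of_adj_left h.left_mem hz
  have h2 := h'.of_adj_left h'.left_mem hz
  by_cases hzw : z = w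
  · exact Or.inl hzw
  by_cases hzy : z = y
  · exact Or.inr (Or.inl hzy)
  rcases hcl z (by tauto) (by tauto) with h3 | h3
  · rcases h0 z h3.1 h3.2 with h4 | h4
    · exact absurd h4 hz.ne.symm
    · exact Or.inr (Or.inr h4)
  · exact Or.inr (Or.inr h3)

/-- A side of a fat separation that is properly contained in `A` would contradict minimality. -/
lemma IsFatSep.not_subset [Finite W]
    (hmin : ∀ x' y' A' B' u' v', G.IsFatSep x' y' A' B' u' v' → A.ncard ≤ A'.ncard)
    (h' : G.IsFatSep s t A' B' p q) (hwA : w ∈ A) (hw : w ∉ A') : ∃ a ∈ A', a ∉ A := by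
  by_contra! hsub
  have h1 : A' ⊂ A := ⟨hsub, fun h => hw (h hwA)⟩
  exact absurd (hmin _ _ _ _ _ _ h') (not_le.2 (Set.ncard_lt_ncard h1))

lemma IsFatSep.notMem_right (hc : G.IsThreeLinked) (h : G.IsFatSep x y A B u v) (hw : w ∈ A)
    (h' : G.IsFatSep x w A' B' p q) : y ∉ B' := by
  intro h1
  have := (h'.eq_of_adj x h'.left_mem y h1 (h.adj hc)).2
  exact h.disj y (this ▸ hw) h.right_mem

/-- The case that `y` lies in the second separator `{y, t}`. If `t ∈ B`, the corner `A ∩ B'` forces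
`u`, `v` into `B'`, and `A ∩ A'` shrinks to `x`. If `t ∉ B`, empty corners make `A'` or `B'` a
proper subset of `A`, or leave `B` with no vertex but `y`. -/
lemma IsFatSep.adj_of_fst_eq [Finite W] (hc : G.IsThreeLinked) (h : G.IsFatSep x y A B u v)
    (hmin : ∀ x' y' A' B' u' v', G.IsFatSep x' y' A' B' u' v' → A.ncard ≤ A'.ncard)
    (hw : w ∈ A) (h' : G.IsFatSep x w A' B' y t) :
    ∀ z, G.Adj x z → z = w ∨ z = y ∨ z = u := by
  have hyA' := h'.fst_notMem_left
  have hyB := h.right_mem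
  have hxA' := h'.left_mem
  have hu1 := h.fst_notMem_left
  have hu2 := h.fst_notMem_right
  have hv1 := h.snd_notMem_left
  have hv2 := h.snd_notMem_right
  have hq1 := h'.snd_notMem_left
  have hq2 := h'.snd_notMem_right
  have hd := h.disj
  have hd' := h'.disj
  have hwA' : w ∉ A' := fun h1 => hd' w h1 h'.right_mem
  have hxB' := hd' x hxA'
  have hyA : y ∉ A := fun h1 => hd y h1 hyB
  have hyB' := h.notMem_right hc hw h'
  obtain ⟨b₁, hb₁, hb₁'⟩ := IsFatSep.not_subset hmin h'.symm h.left_mem hxB'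
  obtain ⟨a₁, ha₁, ha₁'⟩ := IsFatSep.not_subset hmin h' hw hwA'
  have cu := h'.cover u
  have cv := h'.cover v
  have cb := h.cover b₁
  have ca := h.cover a₁
  have hxy : x ≠ y := fun h1 => hyA (h1 ▸ h.left_mem)
  have hxu : x ≠ u := fun h1 => hu1 (h1 ▸ h.left_mem)
  have hxv : x ≠ v := fun h1 => hv1 (h1 ▸ h.left_mem)
  have hwy : w ≠ y := fun h1 => hyA (h1 ▸ hw)
  have hwu : w ≠ u := fun h1 => hu1 (h1 ▸ hw)
  have hwv : w ≠ v := fun h1 => hv1 (h1 ▸ hw)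
  have hyu : y ≠ u := fun h1 => hu2 (h1 ▸ hyB)
  have hyv : y ≠ v := fun h1 => hv2 (h1 ▸ hyB)
  by_cases ht : t ∈ B
  · have hu : u ∈ B' := by
      by_contra hu
      refine h.not_left_inter_right hc hw h' v hyv hwv ?_
      clear cb ca hb₁ hb₁' ha₁ ha₁' hmin
      grind
    have hv : v ∈ B' := by
      by_contra hv
      refine h.not_left_inter_right hc hw h' u hyu hwu ?_
      clear cb ca hb₁ hb₁' ha₁ ha₁' hmin
      grind
    refine h.of_adj_of_left_inter_left hc h' u hwu ?_
    clear cb ca hb₁ hb₁' ha₁ ha₁' hmin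
    grind
  exfalso
  have E4 := fun r h1 h2 => h.right_inter_right hc hw h' hyB' y r hxy h1 h2 b₁
  have E3 := fun r h1 h2 => h.right_inter_left hc hw h' y r hwy h1
    (fun h3 => absurd h3 h'.fst_notMem_left) h2 a₁
  by_cases hu : u ∈ B'
  · by_cases hv : v ∈ B'
    · have := E3 y hwy (by clear E4 E3; grind)
      clear E4 E3
      grind
    · by_cases hv' : v ∈ A'
      · obtain ⟨b, hb, hby⟩ := h.exists_right
        have h1 := h.right_inter_right hc hw h' hyB' y u hxy hxu (by clear E4 E3; grind) b hb
        have h2 := h.right_inter_left hc hw h' y v hwy hwv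
          (fun h3 => absurd h3 h'.fst_notMem_left) (by clear E4 E3; grind) b hb
        have := h'.cover b
        have := h.cover t
        clear E4 E3
        grind
      · have := E3 v hwv (by clear E4 E3; grind)
        clear E4 E3
        grind
  · by_cases hv : v ∈ B'
    · by_cases hu' : u ∈ A'
      · obtain ⟨b, hb, hby⟩ := h.exists_right
        have h1 := h.right_inter_right hc hw h' hyB' y v hxy hxv (by clear E4 E3; grind) b hb
        have h2 := h.right_inter_left hc hw h' y u hwy hwu
          (fun h3 => absurd h3 h'.fst_notMem_left) (by clear E4 E3; grind) b hb
        have := h'.cover b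
        have := h.cover t
        clear E4 E3
        grind
      · have := E3 u hwu (by clear E4 E3; grind)
        clear E4 E3
        grind
    · by_cases hvt : v = t
      · have := E4 v hxv (by clear E4 E3; grind)
        clear E4 E3
        grind
      · have := E4 u hxu (by clear E4 E3; grind)
        clear E4 E3
        grind

/-- If `q ∈ B`, the corner `B ∩ A' ∋ y` keeps one of `u`, `v` out of `B'`, hence `B ∩ B'` is empty
and `B'` is too small. If `q ∉ B`, the same corner keeps both out, and `B'` would lie inside `A`. -/
lemma IsFatSep.not_of_fst_mem [Finite W] (hc : G.IsThreeLinked) (h : G.IsFatSep x y A B u v)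
    (hmin : ∀ x' y' A' B' u' v', G.IsFatSep x' y' A' B' u' v' → A.ncard ≤ A'.ncard)
    (hw : w ∈ A) (h' : G.IsFatSep x w A' B' p q) (hy : y ∈ A') (hp : p ∈ A) : False := by
  have hyB := h.right_mem
  have hxA' := h'.left_mem
  have hu1 := h.fst_notMem_left
  have hu2 := h.fst_notMem_right
  have hv1 := h.snd_notMem_left
  have hv2 := h.snd_notMem_right
  have hp1 := h'.fst_notMem_left
  have hp2 := h'.fst_notMem_right
  have hq1 := h'.snd_notMem_left
  have hq2 := h'.snd_notMem_right
  have hd := h.disj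
  have hd' := h'.disj
  have hwA' : w ∉ A' := fun h1 => hd' w h1 h'.right_mem
  have hxB' := hd' x hxA'
  have hyA : y ∉ A := fun h1 => hd y h1 hyB
  have hyB' := h.notMem_right hc hw h'
  have cu := h'.cover u
  have cv := h'.cover v
  have hxy : x ≠ y := fun h1 => hyA (h1 ▸ h.left_mem)
  have hxu : x ≠ u := fun h1 => hu1 (h1 ▸ h.left_mem)
  have hxv : x ≠ v := fun h1 => hv1 (h1 ▸ h.left_mem)
  have hxp : x ≠ p := fun h1 => hp1 (h1 ▸ hxA')
  have hxq : x ≠ q := fun h1 => hq1 (h1 ▸ hxA')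
  have hwx : w ≠ x := fun h1 => hxB' (h1 ▸ h'.right_mem)
  have hwy : w ≠ y := fun h1 => hyA (h1 ▸ hw)
  have hwu : w ≠ u := fun h1 => hu1 (h1 ▸ hw)
  have hwv : w ≠ v := fun h1 => hv1 (h1 ▸ hw)
  have hwq : w ≠ q := fun h1 => hq2 (h1 ▸ h'.right_mem)
  have hyu : y ≠ u := fun h1 => hu2 (h1 ▸ hyB)
  have hyv : y ≠ v := fun h1 => hv2 (h1 ▸ hyB)
  have hyq : y ≠ q := fun h1 => hq1 (h1 ▸ hy)
  by_cases hq : q ∈ B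
  · have hno : u ∉ B' ∨ v ∉ B' := by
      by_contra! hno
      have := h.right_inter_left hc hw h' x q hwx hwq (by simp) (by grind) y hyB hy
      grind
    -- Such a `B'` gains at most `v` over `A` but misses both `x` and `p`, so it has fewer elements.
    have hcard : ∀ v, v ∉ A → (∀ b ∈ B', b ∈ A ∨ b = v) → False := by
      intro v hv hsub
      have h1 : B' ⊆ insert v (A \ {x, p}) := by
        intro b hb
        have := hsub b hb
        have : b ≠ x := fun h1 => hxB' (h1 ▸ hb)
        have : b ≠ p := fun h1 => hp2 (h1 ▸ hb)
        grind
      have h2 := Set.ncard_le_ncard h1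
      have h3 := Set.ncard_insert_le v (A \ {x, p})
      have h4 := Set.ncard_sdiff_add_ncard_of_subset (s := {x, p}) (t := A)
        (by have := h.left_mem; grind)
      rw [Set.ncard_pair hxp] at h4
      have h5 := hmin _ _ _ _ _ _ h'.symm
      omega
    rcases hno with hu | hv
    · have E4 := h.right_inter_right hc hw h' hyB' v q hxv hxq (by grind)
      refine hcard v hv1 ?_
      intro b hb
      have := E4 b
      have := h.cover b
      grind
    · have E4 := h.right_inter_right hc hw h' hyB' u q hxu hxq (by grind)
      refine hcard u hu1 ?_
      intro b hb
      have := E4 b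
      have := h.cover b
      grind
  · obtain ⟨b₁, hb₁, hb₁'⟩ := IsFatSep.not_subset hmin h'.symm h.left_mem hxB'
    have cb := h.cover b₁
    have E4 := h.right_inter_right hc hw h' hyB' u v hxu hxv (by grind) b₁
    have hu : u ∉ B' := by
      intro hu
      have := h.right_inter_left hc hw h' x v hwx hwv (by simp) (by grind) y hyB hy
      grind
    have hv : v ∉ B' := by
      intro hu
      have := h.right_inter_left hc hw h' x u hwx hwu (by simp) (by grind) y hyB hy
      grind
    grind

/-- The corner `A ∩ B' ∋ w` keeps `u` and `v` out of `A'`. If both lay in the second separator, `B ∩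
B'` would be empty and `B' ⊆ A`; so the corner `A ∩ A'` has at most one exit besides those through
`x`. -/
lemma IsFatSep.adj_of_notMem [Finite W] (hc : G.IsThreeLinked) (h : G.IsFatSep x y A B u v)
    (hmin : ∀ x' y' A' B' u' v', G.IsFatSep x' y' A' B' u' v' → A.ncard ≤ A'.ncard)
    (hw : w ∈ A) (h' : G.IsFatSep x w A' B' p q) (hp : p ∉ A) (hq : q ∉ A) :
    ∃ s, (s = u ∨ s = v) ∧ ∀ z, G.Adj x z → z = w ∨ z = y ∨ z = s := by
  have hyB := h.right_mem
  have hxA' := h'.left_mem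
  have hu1 := h.fst_notMem_left
  have hu2 := h.fst_notMem_right
  have hv1 := h.snd_notMem_left
  have hv2 := h.snd_notMem_right
  have hp1 := h'.fst_notMem_left
  have hp2 := h'.fst_notMem_right
  have hq1 := h'.snd_notMem_left
  have hq2 := h'.snd_notMem_right
  have hd := h.disj
  have hd' := h'.disj
  have hxB' := hd' x hxA'
  have hyA : y ∉ A := fun h1 => hd y h1 hyB
  have hyB' := h.notMem_right hc hw h'
  have cu := h'.cover u
  have cv := h'.cover v
  have cp := h.cover p
  have cq := h.cover q
  have hxu : x ≠ u := fun h1 => hu1 (h1 ▸ h.left_mem)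
  have hxv : x ≠ v := fun h1 => hv1 (h1 ▸ h.left_mem)
  have hwu : w ≠ u := fun h1 => hu1 (h1 ▸ hw)
  have hwv : w ≠ v := fun h1 => hv1 (h1 ▸ hw)
  have hyu : y ≠ u := fun h1 => hu2 (h1 ▸ hyB)
  have hyv : y ≠ v := fun h1 => hv2 (h1 ▸ hyB)
  have hu : u ∉ A' := by
    intro hu
    exact h.not_left_inter_right hc hw h' v hyv hwv (by grind)
  have hv : v ∉ A' := by
    intro hu
    exact h.not_left_inter_right hc hw h' u hyu hwu (by grind)
  by_cases hS : p ∉ B ∧ q ∉ B ∧ p ≠ q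
  · obtain ⟨b₁, hb₁, hb₁'⟩ := IsFatSep.not_subset hmin h'.symm h.left_mem hxB'
    have cb := h.cover b₁
    have E4 := h.right_inter_right hc hw h' hyB' u v hxu hxv (by grind) b₁
    grind
  · by_cases huS : u = p ∨ u = q
    · exact ⟨u, Or.inl rfl, h.of_adj_of_left_inter_left hc h' u hwu (by grind)⟩
    · exact ⟨v, Or.inr rfl, h.of_adj_of_left_inter_left hc h' v hwv (by grind)⟩

/-- If `(A, B)` is a fat separation with `|A|` minimal and there is a fat separation for an edge
from `x` to a vertex `w` of `A`, then `x` has at most one neighbour besides `w` and `y`. -/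
lemma IsFatSep.adj_of_isFatSep [Finite W] (hc : G.IsThreeLinked) (h : G.IsFatSep x y A B u v)
    (hmin : ∀ x' y' A' B' u' v', G.IsFatSep x' y' A' B' u' v' → A.ncard ≤ A'.ncard)
    (hw : w ∈ A) (h' : G.IsFatSep x w A' B' p q) :
    ∃ s, (s = u ∨ s = v) ∧ ∀ z, G.Adj x z → z = w ∨ z = y ∨ z = s := by
  rcases h'.cover y with hy | hy | rfl | rfl
  · by_cases hp : p ∈ A
    · exact (h.not_of_fst_mem hc hmin hw h' hy hp).elim
    by_cases hq : q ∈ A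
    · exact (h.not_of_fst_mem hc hmin hw h'.swap hy hq).elim
    exact h.adj_of_notMem hc hmin hw h' hp hq
  · exact absurd hy (h.notMem_right hc hw h')
  · exact ⟨u, Or.inl rfl, h.adj_of_fst_eq hc hmin hw h'⟩
  · exact ⟨u, Or.inl rfl, h.adj_of_fst_eq hc hmin hw h'.swap⟩

/-- In a minimal fat separation with `A = {x, w}`, the vertex `x` does not have degree three. -/
lemma IsFatSep.false_of_pair (hc : G.IsThreeLinked)
    (h5 : ∀ a b c d : W, ∃ z, z ≠ a ∧ z ≠ b ∧ z ≠ c ∧ z ≠ d)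
    (hbad : ∀ x y, G.Adj x y → G.IsObstructed x y) (h : G.IsFatSep x y A B u v)
    (hA : ∀ a ∈ A, a = x ∨ a = w) (hw : w ∈ A) (hs : s = u ∨ s = v)
    (hx : ∀ z, G.Adj x z → z = w ∨ z = y ∨ z = s) : False := by
  have hx' : ∀ z, G.Adj x z ↔ z = w ∨ z = y ∨ z = s := by
    intro z
    refine ⟨hx z, ?_⟩
    obtain ⟨a, ha, hau, hav⟩ := hc.exists_adj h5 x w y
    obtain ⟨b, hb, hbx, hbu⟩ := hc.exists_adj h5 x w s
    obtain ⟨d, hd, hdx, hdv⟩ := hc.exists_adj h5 x y s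
    have h1 := hx a ha
    have h2 := hx b hb
    have h3 := hx d hd
    grind
  have hxs := hbad x s ((hx' s).2 (by simp))
  rcases hs with rfl | rfl
  · exact h.swap.not_isObstructed hc h5 hA hx' hw hxs
  · exact h.not_isObstructed hc h5 hA hx' hw hxs

/-- A simple 3-connected graph with at least five vertices has an edge whose removal leaves
a simple 3-connected graph. -/
theorem IsThreeLinked.exists_not_isObstructed [Finite W] [Nonempty W] (hc : G.IsThreeLinked)
    (h5 : ∀ a b c d : W, ∃ z, z ≠ a ∧ z ≠ b ∧ z ≠ c ∧ z ≠ d) :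
    ∃ x y, G.Adj x y ∧ ¬ G.IsObstructed x y := by
  by_contra! hbad
  by_cases hfat : ∃ x y A B u v, G.IsFatSep x y A B u v
  · have hmin : ∃ x y A B u v, G.IsFatSep x y A B u v ∧
        ∀ x' y' A' B' u' v', G.IsFatSep x' y' A' B' u' v' → A.ncard ≤ A'.ncard := by
      obtain ⟨A, ⟨x, y, B, u, v, h⟩, hA⟩ := exists_minimalFor_of_wellFoundedLT
        (fun A : Set W => ∃ x y B u v, G.IsFatSep x y A B u v) Set.ncard
        (by obtain ⟨x, y, A, B, u, v, h⟩ := hfat; exact ⟨A, x, y, B, u, v, h⟩)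
      refine ⟨x, y, A, B, u, v, h, fun x' y' A' B' u' v' h' => ?_⟩
      exact (le_total A.ncard A'.ncard).elim id fun h1 => hA ⟨x', y', B', u', v', h'⟩ h1
    obtain ⟨x, y, A, B, u, v, h, hmin⟩ := hmin
    have hxA := h.left_mem
    have hyB := h.right_mem
    -- Otherwise moving `x` to the other side gives a fat separation with smaller left side.
    have hpair : ∀ w ∈ A, G.Adj x w → (∀ z ∈ A, G.Adj x z → z = w) → ∀ a ∈ A, a = x ∨ a = w := by
      intro w hw hxw huniq a ha
      by_contra! hcon
      have h1 := hmin _ _ _ _ _ _ (h.shift hw hxw huniq ⟨a, ha, hcon⟩)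
      have h2 := Set.ncard_sdiff_singleton_lt_of_mem hxA
      omega
    have hnofat : ∀ w ∈ A, G.Adj x w → ¬ ∃ A' B' p q, G.IsFatSep x w A' B' p q := by
      rintro w hw hxw ⟨A', B', p, q, h'⟩
      obtain ⟨s, hs, hx⟩ := h.adj_of_isFatSep hc hmin hw h'
      refine h.false_of_pair hc h5 hbad (hpair w hw hxw ?_) hw hs hx
      intro z hz hxz
      have h1 := h.disj z hz
      have h2 := h.fst_notMem_left
      have h3 := h.snd_notMem_left
      have h4 := hx z hxz
      grind
    -- every neighbour of `x` in `A` has degree three and lies on a triangle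
    have htri : ∀ w ∈ A, G.Adj x w → G.IsTri w x := by
      intro w hw hxw
      rcases hbad x w hxw with h1 | ⟨p, q, hpq, hpw, hqw, hadj, hx⟩ | h1
      · exact absurd h1 (hnofat w hw hxw)
      · exfalso
        -- Here `y` and the third neighbour `s` of `x` are adjacent; a common neighbour of `x` and
        -- `y` lies in the separator, so `false_of_pair` applies.
        have hxy := (hx y).1 (h.adj hc)
        have hyw : y ≠ w := fun h1 => h.disj w hw (h1 ▸ hyB)
        obtain ⟨s, hs, hys⟩ : ∃ s, (∀ z, G.Adj x z ↔ z = w ∨ z = y ∨ z = s) ∧ G.Adj y s ∧ s ≠ y := by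
          rcases hxy with h1 | rfl | rfl
          · exact absurd h1 hyw
          · exact ⟨q, by grind, hadj, hpq.symm⟩
          · exact ⟨p, by grind, hadj.symm, hpq⟩
        have hxs : G.Adj x s := (hs s).2 (by simp)
        have hsA : s ∉ A := by
          intro hsA
          have := (h.eq_of_adj s hsA y hyB hys.1.symm).1
          exact hxs.ne this.symm
        have hsB : s ∉ B := fun hsB => hys.2 (h.eq_of_adj x hxA s hsB hxs).2
        have hsuv : s = u ∨ s = v := by
          have := h.cover s
          tauto
        refine h.false_of_pair hc h5 hbad (hpair w hw hxw ?_) hw hsuv fun z => (hs z).1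
        intro z hz hxz
        have h1 := h.disj z hz
        have h4 := (hs z).1 hxz
        grind
      · exact h1
    obtain ⟨w, hw, hxw⟩ := h.exists_adj_left hc
    obtain ⟨p, q, hpq, hpx, hqx, hadj, hN⟩ := htri w hw hxw
    have hno : ∀ p q, p ≠ x → q ≠ x → G.Adj p q → p ≠ q →
        (∀ z, G.Adj w z ↔ z = x ∨ z = p ∨ z = q) → ¬ ∃ A' B' s t, G.IsFatSep w p A' B' s t := by
      rintro p q hpx hqx hadj hpq hN ⟨A', B', s, t, h'⟩
      have hwp : G.Adj w p := (hN p).2 (by simp)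
      have hwq : G.Adj w q := (hN q).2 (by simp)
      have key : ∀ t, G.IsFatSep w p A' B' q t → False := by
        clear h' s t
        intro t h'
        have hwA' := h'.left_mem
        have hpB' := h'.right_mem
        have hwB' := h'.disj w hwA'
        have hqA' := h'.fst_notMem_left
        have hpA' : p ∉ A' := fun h1 => h'.disj p h1 hpB'
        have hxA' : x ∈ A' := by
          by_contra hxA'
          obtain ⟨c, hcA, hwc⟩ := h'.exists_adj_left hc
          have h1 := (hN c).1 hwc
          grind
        have huniq : ∀ z ∈ A', G.Adj w z → z = x := by
          intro z hz hwz
          have := (hN z).1 hwz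
          grind
        -- If `A'` has a third vertex, moving `w` across turns the separation for `wp` into one for
        -- `xw`, which was excluded. Otherwise `A' = {w, x}`, and `x` has only the neighbours `w`,
        -- `q` and `t = y`.
        by_cases hex : ∃ a ∈ A', a ≠ w ∧ a ≠ x
        · exact hnofat w hw hxw ⟨_, _, _, _, h'.shift hxA' hxw.symm huniq hex⟩
        · have hA' : ∀ a ∈ A', a = w ∨ a = x := by
            intro a ha
            by_contra! hcon
            exact hex ⟨a, ha, hcon⟩
          have hxsub : ∀ z, G.Adj x z → z = w ∨ z = q ∨ z = t := by
            intro z hz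
            have h1 := h'.of_adj_left hxA' hz
            have h2 := hA' z
            have h3 := hz.ne
            have h4 := hxw.ne
            grind
          have hqB : q ∉ B := by
            intro hqB
            exact hxw.ne (h.eq_of_adj w hw q hqB hwq).1.symm
          have hyw : y ≠ w := fun h1 => h.disj w hw (h1 ▸ hyB)
          have hty : t = y := by
            have := hxsub y (h.adj hc)
            grind
          subst hty
          have hxq : G.Adj x q := by
            obtain ⟨z, hz, hzw, hzt⟩ := hc.exists_adj h5 x w t
            have := hxsub z hz
            grind
          -- If `q ∈ A`, it also has degree three, so `{w, x, q}` can be left only towards `y` and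
          -- `p`. Otherwise `q` is `u` or `v`, and `A = {x, w}` follows.
          by_cases hqA : q ∈ A
          · obtain ⟨p', q', hpq', hpx', hqx', hadj', hN'⟩ := htri q hqA hxq
            have hNq : ∀ z, G.Adj q z → z = x ∨ z = w ∨ z = p := by
              have h1 := (hN' w).1 hwq.symm
              have h2 := (hN' p).1 hadj.symm
              have h3 := hxw.ne
              have h4 := hwp.ne
              intro z hz
              have := (hN' z).1 hz
              grind
            obtain ⟨z, hzw, hzx, hzq, hzp⟩ := h5 w x q p
            by_cases hzt : z = t
            · obtain ⟨b, hb, hbt⟩ := h.exists_right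
              have h1 := h.disj
              obtain ⟨c, d, hcd, hcQ, hct, hcp, hdQ, hdt, hdp⟩ := hc {w, x, q} t p w b (by simp)
                hyw.symm hwp.ne (by grind) hbt (by
                  rintro rfl
                  exact hxw.ne (h.eq_of_adj w hw b hb hwp).1.symm)
              have h1 := hN d
              have h2 := hxsub d
              have h3 := hNq d
              grind
            · obtain ⟨c, d, hcd, hcQ, hct, hcp, hdQ, hdt, hdp⟩ := hc {w, x, q} t p w z (by simp)
                hyw.symm hwp.ne (by grind) hzt hzp
              have h1 := hN d
              have h2 := hxsub d
              have h3 := hNq d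
              grind
          · have hquv : q = u ∨ q = v := by
              have := h.cover q
              tauto
            refine h.false_of_pair hc h5 hbad (hpair w hw hxw ?_) hw hquv
              (fun z hz => by have := hxsub z hz; tauto)
            intro z hz hxz
            have h1 := h.disj z hz
            have h4 := hxsub z hxz
            grind
      have hS : q = s ∨ q = t := by
        have h1 := h'.cover q
        have h2 := h'.of_adj_left (s := q) h'.left_mem hwq
        have h3 := h'.of_adj_right (s := q) h'.right_mem hadj
        have h4 := h'.disj q
        have h5 := hwq.ne
        grind
      rcases hS with rfl | rfl
      · exact key t h'
      · exact key s h'.swap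
    rcases hc.isFatSep_of_isTri h5 hbad hN hadj hpx.symm hqx.symm with h1 | h1
    · exact hno p q hpx hqx hadj hpq hN h1
    · exact hno q p hqx hpx hadj.symm hpq.symm (by grind) h1
  · obtain ⟨x⟩ := ‹Nonempty W›
    obtain ⟨y, hxy, -⟩ := hc.exists_adj h5 x x x
    have key : ∀ x y, G.Adj x y → ¬ G.IsTri x y := by
      rintro x y hxy ⟨p, q, hpq, hpy, hqy, hadj, hN⟩
      rcases hc.isFatSep_of_isTri h5 hbad hN hadj hpy.symm hqy.symm with
        ⟨A, B, u, v, h⟩ | ⟨A, B, u, v, h⟩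
      · exact hfat ⟨_, _, _, _, _, _, h⟩
      · exact hfat ⟨_, _, _, _, _, _, h⟩
    rcases hbad x y hxy with ⟨A, B, u, v, h⟩ | h | h
    · exact hfat ⟨_, _, _, _, _, _, h⟩
    · exact key x y hxy h
    · exact key y x hxy.symm h

end Removable

end SimpleGraph

namespace Graph

/-! ### Turning an unobstructed edge into an inverse BG-operation. -/

section Existence

variable {α β : Type*} {G H K : Graph α β} {a b c d p q s t u v w x y z : α} {e f g : β}

/-- No two vertices together with the edge `xy` separate `x` and another vertex from
`y` and another vertex. -/
def NoFatSep (G : Graph α β) (x y : α) : Prop :=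
  ∀ (A B : Set α) (u v : α), u ∈ V(G) → v ∈ V(G) → x ∈ A → y ∈ B → u ∉ A → u ∉ B → v ∉ A → v ∉ B →
    (∀ a ∈ A, a ∉ B) → (∀ w ∈ V(G), w ∈ A ∨ w ∈ B ∨ w = u ∨ w = v) →
    (∀ a ∈ A, ∀ b ∈ B, G.Adj a b → a = x ∧ b = y) → (∃ a ∈ A, a ∈ V(G) ∧ a ≠ x) →
    (∃ b ∈ B, b ∈ V(G) ∧ b ≠ y) → False

lemma NoFatSep.symm (h : G.NoFatSep x y) : G.NoFatSep y x := by
  intro A B u v hu hv hx hy h1 h2 h3 h4 h5 h6 h7 h8 h9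
  refine h B A u v hu hv hy hx h2 h1 h4 h3 (fun a ha hb => h5 a hb ha) ?_ ?_ h9 h8
  · intro w hw
    have := h6 w hw
    tauto
  · intro a ha b hb hab
    exact (h7 b hb a ha hab.symm).symm

/-- Transfers `exists_not_isObstructed` from the simple graph on the vertex set of `G` back to `G`.
-/
lemma IsKConnected.exists_noFatSep (hG : G.IsKConnected 3) (hs : G.Simple) (hf : V(G).Finite)
    (h5 : 5 ≤ V(G).encard) : ∃ x y, G.Adj x y ∧ G.NoFatSep x y ∧
      (∀ p q, p ≠ q → p ≠ y → q ≠ y → G.Adj p q → ¬ ∀ w, G.Adj x w ↔ w = y ∨ w = p ∨ w = q) ∧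
      (∀ p q, p ≠ q → p ≠ x → q ≠ x → G.Adj p q → ¬ ∀ w, G.Adj y w ↔ w = x ∨ w = p ∨ w = q) := by
  have hfin : Finite V(G) := hf
  obtain ⟨v₀, hv₀, -⟩ : ∃ v₀ ∈ V(G), True := by
    by_contra! hcon
    have : V(G) = ∅ := by grind
    simp [this] at h5
  have : Nonempty V(G) := ⟨⟨v₀, hv₀⟩⟩
  have hadj : ∀ u v : V(G), G.toSimpleGraph.Adj u v ↔ G.Adj u v := toSimpleGraph_adj_iff
  have hc : G.toSimpleGraph.IsThreeLinked := by
    intro Q p q a z ha hap haq hz hzp hzq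
    obtain ⟨c, d, hcd, hcQ, hcp, hcq, hdQ, hdp, hdq⟩ := hG.crossing (Subtype.val '' Q) p q
      a.2 z.2 (Set.mem_image_of_mem _ ha) (by simpa [Subtype.ext_iff] using hap)
      (by simpa [Subtype.ext_iff] using haq) (by simpa using hz)
      (by simpa [Subtype.ext_iff] using hzp) (by simpa [Subtype.ext_iff] using hzq)
    refine ⟨⟨c, hcd.left_mem⟩, ⟨d, hcd.right_mem⟩, (hadj _ _).2 hcd, ?_, ?_, ?_, ?_, ?_, ?_⟩
    · obtain ⟨c', hc', rfl⟩ := hcQ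
      exact hc'
    · simpa [Subtype.ext_iff] using hcp
    · simpa [Subtype.ext_iff] using hcq
    · intro h
      exact hdQ ⟨_, h, rfl⟩
    · simpa [Subtype.ext_iff] using hdp
    · simpa [Subtype.ext_iff] using hdq
  have h5' : ∀ a b c d : V(G), ∃ z, z ≠ a ∧ z ≠ b ∧ z ≠ c ∧ z ≠ d := by
    intro a b c d
    by_contra! hcon
    have h1 : V(G) ⊆ {a.1, b.1, c.1, d.1} := by
      intro z hz
      have := hcon ⟨z, hz⟩
      simp only [Subtype.ext_iff, ne_eq] at this
      grind
    have h2 := h5.trans (Set.encard_le_encard h1)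
    have h3 : ({a.1, b.1, c.1, d.1} : Set α).encard ≤ 4 := by
      refine (Set.encard_insert_le _ _).trans ?_
      calc _ ≤ ((2 : ℕ∞) + 1) + 1 := by
            gcongr
            refine (Set.encard_insert_le _ _).trans ?_
            gcongr
            exact encard_pair_le_two _ _
        _ = 4 := by norm_num
    have := h2.trans h3
    norm_num at this
  obtain ⟨x, y, hxy, hno⟩ := hc.exists_not_isObstructed h5'
  simp only [SimpleGraph.IsObstructed, not_or] at hno
  have htri : ∀ x y : V(G), ¬ G.toSimpleGraph.IsTri x y → ∀ p q, p ≠ q → p ≠ y.1 → q ≠ y.1 →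
      G.Adj p q → ¬ ∀ w, G.Adj x w ↔ w = y ∨ w = p ∨ w = q := by
    intro x y h p q hpq hpy hqy hadj' hw
    refine h ⟨⟨p, hadj'.left_mem⟩, ⟨q, hadj'.right_mem⟩, by simpa using hpq,
      by simpa [Subtype.ext_iff] using hpy, by simpa [Subtype.ext_iff] using hqy,
      (hadj _ _).2 hadj', ?_⟩
    intro w
    rw [hadj, hw]
    simp [Subtype.ext_iff]
  refine ⟨x, y, (hadj _ _).1 hxy, ?_, htri x y hno.2.1, htri y x hno.2.2⟩
  intro A B u v hu hv hx hy h1 h2 h3 h4 h5 h6 h7 h8 h9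
  refine hno.1 ⟨Subtype.val ⁻¹' A, Subtype.val ⁻¹' B, ⟨u, hu⟩, ⟨v, hv⟩, hx, hy, h1, h2, h3, h4,
    fun a => h5 a, ?_, ?_, ?_, ?_⟩
  · intro w
    have := h6 w w.2
    simpa [Subtype.ext_iff] using this
  · intro a ha b hb hab
    have := h7 a ha b hb ((hadj _ _).1 hab)
    simpa [Subtype.ext_iff] using this
  · obtain ⟨a, ha, haV, hax⟩ := h8
    exact ⟨⟨a, haV⟩, ha, by simpa [Subtype.ext_iff] using hax⟩
  · obtain ⟨a, ha, haV, hax⟩ := h9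
    exact ⟨⟨a, haV⟩, ha, by simpa [Subtype.ext_iff] using hax⟩

/-- A criterion for 3-connectivity of the graph `H` that arises from `G` by removing the
edge `xy`. -/
lemma NoFatSep.isKConnected (hG : G.IsKConnected 3) (hL : G.Loopless) (hfat : G.NoFatSep x y)
    (h4 : 3 < V(H).encard) (hVH : V(H) ⊆ V(G)) (hV : ∀ w ∈ V(G), w ∈ V(H) ∨ w = x ∨ w = y)
    (hadj : ∀ c ∈ V(H), ∀ d ∈ V(H), G.Adj c d → ¬ (c = x ∧ d = y) → ¬ (c = y ∧ d = x) → H.Adj c d)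
    (hx : x ∉ V(H) → ∃ a b, H.Adj a b ∧ ∀ z, G.Adj x z → z = y ∨ z = a ∨ z = b)
    (hy : y ∉ V(H) → ∃ a b, H.Adj a b ∧ ∀ z, G.Adj y z → z = x ∨ z = a ∨ z = b)
    (hx' : x ∈ V(H) → ∀ p q, ∃ z, G.Adj x z ∧ z ≠ y ∧ z ≠ p ∧ z ≠ q)
    (hy' : y ∈ V(H) → ∀ p q, ∃ z, G.Adj y z ∧ z ≠ x ∧ z ≠ p ∧ z ≠ q) : H.IsKConnected 3 := by
  refine isKConnected_three_of_crossing h4 ?_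
  intro Q p q s t hp hq hpq hs ht hsQ hsp hsq htQ htp htq
  by_contra hcon
  have hcon' : ∀ u v, H.Adj u v → u ≠ p → u ≠ q → v ≠ p → v ≠ q → u ∈ Q → v ∈ Q := by
    intro u v huv hup huq hvp hvq hu
    by_contra hv
    exact hcon ⟨u, v, huv, hu, hup, huq, hv, hvp, hvq⟩
  clear hcon
  -- A smoothed end has its remaining neighbours among two vertices adjacent in `H`, so those not
  -- deleted lie on one side. The proposition `S` records whether this side is `Q`.
  have hside : ∀ x y : α, (x ∉ V(H) → ∃ a b, H.Adj a b ∧ ∀ z, G.Adj x z → z = y ∨ z = a ∨ z = b) →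
      ∃ S : Prop, x ∉ V(H) → ∀ z, G.Adj x z → z ≠ y → z ≠ p → z ≠ q → (z ∈ Q ↔ S) := by
    intro x y hx
    by_cases hxV : x ∈ V(H)
    · exact ⟨True, fun h => absurd hxV h⟩
    · obtain ⟨a, b, hab, h⟩ := hx hxV
      refine ⟨a ∈ Q ∧ a ≠ p ∧ a ≠ q ∨ b ∈ Q ∧ b ≠ p ∧ b ≠ q, fun _ z hz hzy hzp hzq => ?_⟩
      have h1 := hcon' a b hab
      have h2 := hcon' b a hab.symm
      have h3 := h z hz
      clear hadj hV hcon'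
      grind
  obtain ⟨Sx, hSx⟩ := hside x y hx
  obtain ⟨Sy, hSy⟩ := hside y x hy
  clear hside hx hy
  -- The side `Q` is lifted to `G` by placing each smoothed end with its neighbours. Then only `xy`
  -- can cross, and it yields a forbidden fat separation.
  obtain ⟨A, hA⟩ : ∃ A : Set α, ∀ c, c ∈ A ↔ c ≠ p ∧ c ≠ q ∧ (c ∈ V(H) ∧ c ∈ Q ∨
    c ∉ V(H) ∧ c = x ∧ Sx ∨ c ∉ V(H) ∧ c = y ∧ Sy) := ⟨{c | _}, fun c => Iff.rfl⟩
  have hpA : p ∉ A := fun h => ((hA p).1 h).1 rfl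
  have hqA : q ∉ A := fun h => ((hA q).1 h).2.1 rfl
  have hN : ∀ c d, G.Adj c d → c ∈ A → d ∉ A → d ≠ p → d ≠ q →
      c = x ∧ d = y ∨ c = y ∧ d = x := by
    intro c d hcd hc hd hdp hdq
    have h1 := (hA c).1 hc
    have h2V : d ∈ V(H) → d ∉ Q := fun hV hQ => hd ((hA d).2 ⟨hdp, hdq, Or.inl ⟨hV, hQ⟩⟩)
    have h2x : d ∉ V(H) → d = x → ¬ Sx := fun h1 h2 h3 =>
      hd ((hA d).2 ⟨hdp, hdq, Or.inr (Or.inl ⟨h1, h2, h3⟩)⟩)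
    have h2y : d ∉ V(H) → d = y → ¬ Sy := fun h1 h2 h3 =>
      hd ((hA d).2 ⟨hdp, hdq, Or.inr (Or.inr ⟨h1, h2, h3⟩)⟩)
    have hd' := hV d hcd.right_mem
    have hne := hcd.ne
    by_contra! hpair
    by_cases hcV : c ∈ V(H)
    · have hcQ : c ∈ Q := by
        rcases h1.2.2 with h | h | h
        · exact h.2
        · exact absurd hcV h.1
        · exact absurd hcV h.1
      by_cases hdV : d ∈ V(H)
      · exact h2V hdV (hcon' c d (hadj c hcV d hdV hcd (fun h => hpair.1 h.1 h.2)
          (fun h => hpair.2 h.1 h.2)) h1.1 h1.2.1 hdp hdq hcQ)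
      · rcases hd'.resolve_left hdV with h | h
        · refine h2x hdV h ((hSx (h ▸ hdV) c (h ▸ hcd.symm) ?_ h1.1 h1.2.1).1 hcQ)
          exact fun h' => hpair.2 h' h
        · refine h2y hdV h ((hSy (h ▸ hdV) c (h ▸ hcd.symm) ?_ h1.1 h1.2.1).1 hcQ)
          exact fun h' => hpair.1 h' h
    · rcases h1.2.2 with h3 | ⟨-, h, h3⟩ | ⟨-, h, h3⟩
      · exact hcV h3.1
      · have hdy := hpair.1 h
        have hdx : d ≠ x := fun h' => hne (h.trans h'.symm)
        have hdV : d ∈ V(H) := hd'.resolve_right (not_or.2 ⟨hdx, hdy⟩)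
        exact h2V hdV ((hSx (h ▸ hcV) d (h ▸ hcd) hdy hdp hdq).2 h3)
      · have hdx := hpair.2 h
        have hdy : d ≠ y := fun h' => hne (h.trans h'.symm)
        have hdV : d ∈ V(H) := hd'.resolve_right (not_or.2 ⟨hdx, hdy⟩)
        exact h2V hdV ((hSy (h ▸ hcV) d (h ▸ hcd) hdx hdp hdq).2 h3)
  have hsA : s ∈ A := (hA s).2 ⟨hsp, hsq, Or.inl ⟨hs, hsQ⟩⟩
  have htA : t ∉ A := by
    intro h
    rcases ((hA t).1 h).2.2 with h | h | h
    · exact htQ h.2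
    · exact h.1 ht
    · exact h.1 ht
  have key : ∀ x y, G.NoFatSep x y → (x ∈ V(H) → ∀ p q, ∃ z, G.Adj x z ∧ z ≠ y ∧ z ≠ p ∧ z ≠ q) →
      (y ∈ V(H) → ∀ p q, ∃ z, G.Adj y z ∧ z ≠ x ∧ z ≠ p ∧ z ≠ q) →
      (∀ c d, G.Adj c d → c ∈ A → d ∉ A → d ≠ p → d ≠ q → c = x ∧ d = y ∨ c = y ∧ d = x) →
      x ∈ A → y ∉ A → y ≠ p → y ≠ q → False := by
    intro x y hfat hx' hy' hN hxA hyA hyp hyq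
    refine hfat A {w | w ∉ A ∧ w ≠ p ∧ w ≠ q} p q (hVH hp) (hVH hq) hxA ⟨hyA, hyp, hyq⟩ hpA
      (fun h => h.2.1 rfl) hqA (fun h => h.2.2 rfl) (fun a ha h => h.1 ha) ?_ ?_ ?_ ?_
    · intro w hw
      by_cases hwA : w ∈ A
      · exact Or.inl hwA
      by_cases hwp : w = p
      · exact Or.inr (Or.inr (Or.inl hwp))
      by_cases hwq : w = q
      · exact Or.inr (Or.inr (Or.inr hwq))
      exact Or.inr (Or.inl ⟨hwA, hwp, hwq⟩)
    · intro a ha b hb hab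
      rcases hN a b hab ha hb.1 hb.2.1 hb.2.2 with h | h
      · exact h
      · exact absurd (h.2 ▸ hxA) hb.1
    -- If `x` itself is the known vertex of its side, a second one is a neighbour: an unsmoothed `x`
    -- has one besides `y`, `p` and `q`.
    · by_cases hsx : s = x
      · obtain ⟨z, hz, hzy, hzp, hzq⟩ := hx' (hsx ▸ hs) p q
        refine ⟨z, ?_, hz.right_mem, hz.ne.symm⟩
        by_contra hzA
        rcases hN x z hz hxA hzA hzp hzq with h | h
        · exact hzy h.2
        · exact hz.ne h.2.symm
      · exact ⟨s, hsA, hVH hs, hsx⟩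
    · by_cases hty : t = y
      · obtain ⟨z, hz, hzx, hzp, hzq⟩ := hy' (hty ▸ ht) p q
        refine ⟨z, ⟨?_, hzp, hzq⟩, hz.right_mem, hz.ne.symm⟩
        intro hzA
        rcases hN z y hz.symm hzA hyA hyp hyq with h | h
        · exact hzx h.1
        · exact hz.ne h.1.symm
      · exact ⟨t, ⟨htA, htp, htq⟩, hVH ht, hty⟩
  obtain ⟨c, d, hcd, hcA, -, -, hdA, hdp, hdq⟩ := hG.crossing A p q (hVH hs) (hVH ht) hsA hsp hsq
    htA htp htq
  rcases hN c d hcd hcA hdA hdp hdq with ⟨rfl, rfl⟩ | ⟨rfl, rfl⟩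
  · exact key _ _ hfat hx' hy' hN hcA hdA hdp hdq
  · exact key _ _ hfat.symm hy' hx' (fun c d h1 h2 h3 h4 h5 => (hN c d h1 h2 h3 h4 h5).symm)
      hcA hdA hdp hdq

/-- In a simple graph, smoothing a vertex with exactly two, nonadjacent, neighbours leaves
a simple graph. -/
lemma Simple.exists_isSubdividing (hK : K.Simple) (hN : K.nbrs x = {a, b}) (hab : a ≠ b)
    (hnadj : ¬ K.Adj a b) : ∃ f H, H.Simple ∧ V(H) = V(K) \ {x} ∧ E(H) ⊆ E(K) ∧
      H.IsSubdividing f x K ∧ H.IsLink f a b ∧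
      (∀ e u v, K.IsLink e u v → u ≠ x → v ≠ x → H.IsLink e u v) ∧
      ∀ u v, H.Adj u v ↔ K.Adj u v ∧ u ≠ x ∧ v ≠ x ∨ (u = a ∧ v = b ∨ u = b ∧ v = a) := by
  obtain ⟨e₁, h1⟩ : K.Adj x a := by rw [← mem_nbrs, hN]; simp
  obtain ⟨e₂, h2⟩ : K.Adj x b := by rw [← mem_nbrs, hN]; simp
  have h12 : e₁ ≠ e₂ := by
    rintro rfl
    exact hab (h1.right_unique h2)
  have hinc : K.incidenceSet x = {e₁, e₂} := by
    ext e
    constructor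
    · rintro ⟨w, hw⟩
      have : w ∈ K.nbrs x := hw.adj
      rw [hN] at this
      rcases this with rfl | rfl
      · exact Or.inl (hw.eq h1)
      · exact Or.inr (hw.eq h2)
    · rintro (rfl | rfl)
      · exact h1.inc_left
      · exact h2.inc_left
  have hs : K.IsSmoothable x := by
    refine ⟨?_, ?_, ?_⟩
    · rw [deg, loopSet_eq_empty hK.toLoopless, hinc, Set.encard_pair h12]
      simp
    · rw [hN, Set.encard_pair hab]
    · exact K.not_adj_self x
  have hf : e₁ ∉ E(K.deleteVerts {x}) := by
    simp only [mem_edgeSet_iff, deleteVerts_isLink, not_exists]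
    rintro u v ⟨huv, hu, hv⟩
    have := h1.left_eq_or_eq huv
    grind
  have hax := h1.ne
  have hbx := h2.ne
  have ha := h1.right_mem
  have hb := h2.right_mem
  have hle : K.deleteVerts {x} ≤ K := deleteVerts_le
  refine ⟨e₁, _, Simple.addEdge (Simple.anti hle) hab (fun h => hnadj (h.mono hle)), ?_, ?_,
    hs.isSubdividing hK.toLoopless hN hf, by simp, ?_, ?_⟩
  · simp
    grind
  · intro e he
    rw [mem_edgeSet_addEdge] at he
    rcases he with rfl | he
    · exact h1.edge_mem
    · exact hle.edgeSet_mono he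
  · intro e u v he hu hv
    have : e ≠ e₁ := by
      rintro rfl
      have := h1.left_eq_or_eq he
      grind
    simp [this, he, hu, hv]
  · intro u v
    rw [addEdge_adj_of_notMem hf]
    simp [Adj]

/-- Separates degree three, where `x` is smoothed after deleting `xy`, from larger degree, where `x`
stays. -/
lemma IsKConnected.nbrs_cases (hG : G.IsKConnected 3) (hxy : G.Adj x y) :
    (∃ a b, a ≠ b ∧ a ≠ y ∧ b ≠ y ∧ ∀ w, G.Adj x w ↔ w = y ∨ w = a ∨ w = b) ∨
      ∀ p q, ∃ z, G.Adj x z ∧ z ≠ y ∧ z ≠ p ∧ z ≠ q := by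
  by_cases h : ∀ p q, ∃ z, G.Adj x z ∧ z ≠ y ∧ z ≠ p ∧ z ≠ q
  · exact Or.inr h
  · push Not at h
    obtain ⟨p, q, h⟩ := h
    obtain ⟨a, ha, -, hay, -⟩ := hG.exists_adj_ne hxy.left_mem y y
    obtain ⟨b, hb, -, hby, hba⟩ := hG.exists_adj_ne hxy.left_mem y a
    refine Or.inl ⟨a, b, hba.symm, hay, hby, fun w => ⟨fun hw => ?_, ?_⟩⟩
    · have h1 := h w hw
      have h2 := h a ha hay
      have h3 := h b hb hby
      by_cases hap : a = p <;> by_cases hbp : b = p <;> grind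
    · rintro (rfl | rfl | rfl) <;> assumption

lemma deleteEdges_adj_iff (hG : G.Simple) (hl : G.IsLink e x y) :
    (G.deleteEdges {e}).Adj u v ↔ G.Adj u v ∧ ¬ (u = x ∧ v = y) ∧ ¬ (u = y ∧ v = x) := by
  simp only [Adj, deleteEdges_isLink, Set.mem_singleton_iff]
  constructor
  · rintro ⟨f, hf, hfe⟩
    refine ⟨⟨f, hf⟩, ?_, ?_⟩
    · rintro ⟨rfl, rfl⟩
      exact hfe (hf.eq hl)
    · rintro ⟨rfl, rfl⟩
      exact hfe (hf.eq hl.symm)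
  · rintro ⟨⟨f, hf⟩, h1, h2⟩
    refine ⟨f, hf, ?_⟩
    rintro rfl
    have := hf.eq_and_eq_or_eq_and_eq hl
    tauto

lemma ssubset_of_subset_deleteEdges (hl : G.IsLink e x y) (h : E(H) ⊆ E(G.deleteEdges {e})) :
    E(H) ⊂ E(G) := by
  refine ⟨h.trans (by simp), fun h' => ?_⟩
  have := h (h' hl.edge_mem)
  simp at this

lemma NoFatSep.isBGOp_add (hG : G.IsKConnected 3) (hs : G.Simple) (hfat : G.NoFatSep x y)
    (hl : G.IsLink e x y) (hx : ∀ p q, ∃ z, G.Adj x z ∧ z ≠ y ∧ z ≠ p ∧ z ≠ q)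
    (hy : ∀ p q, ∃ z, G.Adj y z ∧ z ≠ x ∧ z ≠ p ∧ z ≠ q) :
    ∃ H : Graph α β, H.Simple ∧ E(H) ⊂ E(G) ∧ V(H) ⊆ V(G) ∧ H.IsBGOp e G := by
  have h3 : (G.deleteEdges {e}).IsKConnected 3 := by
    refine hfat.isKConnected hG hs.toLoopless (by simpa using hG.1) (by simp)
      (fun w hw => Or.inl (by simpa using hw)) ?_ ?_ ?_ (fun _ => hx) (fun _ => hy)
    · intro c _ d _ hcd h1 h2
      exact (deleteEdges_adj_iff hs hl).2 ⟨hcd, h1, h2⟩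
    · intro h
      exact absurd hl.left_mem (by simpa using h)
    · intro h
      exact absurd hl.right_mem (by simpa using h)
  refine ⟨G.deleteEdges {e}, Simple.anti deleteEdges_le, ssubset_of_subset_deleteEdges hl le_rfl,
    by simp, ?_⟩
  have := IsBGOp.add (G := G.deleteEdges {e}) (g := e) x y h3 (by simpa using hl.left_mem)
    (by simpa using hl.right_mem) hl.ne notMem_edgeSet_deleteEdges
  rwa [addEdge_deleteEdges hl] at this

lemma NoFatSep.isBGOp_subdivideOne (hG : G.IsKConnected 3) (hs : G.Simple) (hfat : G.NoFatSep x y)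
    (hl : G.IsLink e x y) (h5 : 5 ≤ V(G).encard) (hab : a ≠ b) (hay : a ≠ y) (hby : b ≠ y)
    (hNx : ∀ w, G.Adj x w ↔ w = y ∨ w = a ∨ w = b) (hnadj : ¬ G.Adj a b)
    (hy : ∀ p q, ∃ z, G.Adj y z ∧ z ≠ x ∧ z ≠ p ∧ z ≠ q) :
    ∃ H : Graph α β, H.Simple ∧ E(H) ⊂ E(G) ∧ V(H) ⊆ V(G) ∧ H.IsBGOp e G := by
  have hxy := hl.ne
  have hDs : (G.deleteEdges {e}).Simple := Simple.anti deleteEdges_le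
  have hN : (G.deleteEdges {e}).nbrs x = {a, b} := by
    ext w
    rw [mem_nbrs, deleteEdges_adj_iff hs hl, hNx]
    grind
  obtain ⟨f, H, hHs, hVH, hEH, hsub, hf, -, hadj⟩ := hDs.exists_isSubdividing hN hab
    (fun h => hnadj (h.mono deleteEdges_le))
  have hVH' : V(H) = V(G) \ {x} := by simpa using hVH
  have h3 : H.IsKConnected 3 := by
    refine hfat.isKConnected hG hs.toLoopless ?_ (by rw [hVH']; exact Set.sdiff_subset)
      (fun w hw => ?_) ?_ ?_ ?_ ?_ (fun _ => hy)
    · rw [hVH']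
      have h1 := Set.encard_sdiff_singleton_add_one hl.left_mem
      have h2 : (4 : ℕ∞) ≤ (V(G) \ {x}).encard := by
        have : (4 : ℕ∞) + 1 ≤ (V(G) \ {x}).encard + 1 := by
          rw [h1]
          exact le_trans (by norm_num) h5
        exact (ENat.add_le_add_iff_right ENat.one_ne_top).1 this
      exact lt_of_lt_of_le (by norm_num) h2
    · rw [hVH']
      by_cases h : w = x
      · exact Or.inr (Or.inl h)
      · exact Or.inl ⟨hw, h⟩
    · intro c hc d hd hcd h1 h2
      rw [hVH'] at hc hd
      rw [hadj, deleteEdges_adj_iff hs hl]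
      exact Or.inl ⟨⟨hcd, h1, h2⟩, hc.2, hd.2⟩
    · intro _
      exact ⟨a, b, hf.adj, fun z hz => (hNx z).1 hz⟩
    · intro h
      rw [hVH'] at h
      exact absurd ⟨hl.right_mem, hxy.symm⟩ h
    · intro h
      rw [hVH'] at h
      exact absurd rfl h.2
  refine ⟨H, hHs, ssubset_of_subset_deleteEdges hl hEH, by rw [hVH']; exact Set.sdiff_subset, ?_⟩
  have := IsBGOp.subdivideOne (g := e) f x y _ h3 hsub (by rw [hVH']; exact ⟨hl.right_mem, hxy.symm⟩)
    (fun h => (h.eq_or_eq_of_isLink hf).elim hay.symm hby.symm) notMem_edgeSet_deleteEdges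
  rwa [addEdge_deleteEdges hl] at this

/-- Beyond the case of one smoothed end, the second smoothing must not create an edge parallel to
`ab`, and four vertices must remain. -/
lemma NoFatSep.isBGOp_subdivideTwo (hG : G.IsKConnected 3) (hs : G.Simple) (hfat : G.NoFatSep x y)
    (hl : G.IsLink e x y) (h5 : 5 ≤ V(G).encard) (hab : a ≠ b) (hay : a ≠ y) (hby : b ≠ y)
    (hNx : ∀ w, G.Adj x w ↔ w = y ∨ w = a ∨ w = b) (hnadj : ¬ G.Adj a b)
    (hcd : c ≠ d) (hcx : c ≠ x) (hdx : d ≠ x)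
    (hNy : ∀ w, G.Adj y w ↔ w = x ∨ w = c ∨ w = d) (hnadj' : ¬ G.Adj c d) :
    ∃ H : Graph α β, H.Simple ∧ E(H) ⊂ E(G) ∧ V(H) ⊆ V(G) ∧ H.IsBGOp e G := by
  have hxy := hl.ne
  have hxa : G.Adj x a := (hNx a).2 (by simp)
  have hxb : G.Adj x b := (hNx b).2 (by simp)
  have hyc : G.Adj y c := (hNy c).2 (by simp)
  have hyd : G.Adj y d := (hNy d).2 (by simp)
  have hxa' := hxa.ne
  have hxb' := hxb.ne
  have hyc' := hyc.ne
  have hyd' := hyd.ne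
  -- Otherwise `a` and `b` would separate `{x, y}` from a fifth vertex.
  have hne : ¬ (c = a ∧ d = b ∨ c = b ∧ d = a) := by
    intro hne
    have : ∃ z ∈ V(G), z ≠ x ∧ z ≠ y ∧ z ≠ a ∧ z ≠ b := by
      by_contra! hcon
      have h6 : V(G) ⊆ {x, y, a, b} := by grind
      have h7 := h5.trans (Set.encard_le_encard h6)
      rw [Set.encard_insert_of_notMem (by grind), Set.encard_insert_of_notMem (by grind),
        Set.encard_pair (by grind)] at h7
      norm_num at h7
    obtain ⟨z, hz, hzx, hzy, hza, hzb⟩ := this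
    obtain ⟨c', d', hcd', h⟩ := hG.crossing {x, y} a b (a := x) (z := z) hl.left_mem hz (by simp)
      hxa' hxb' (by grind) hza hzb
    have h1 := hNx d'
    have h2 := hNy d'
    grind
  have hDs : (G.deleteEdges {e}).Simple := Simple.anti deleteEdges_le
  have hN : (G.deleteEdges {e}).nbrs x = {a, b} := by
    ext w
    rw [mem_nbrs, deleteEdges_adj_iff hs hl, hNx]
    grind
  obtain ⟨f, K, hKs, hVK, hEK, hsub, hf, -, hadj⟩ := hDs.exists_isSubdividing hN hab
    (fun h => hnadj (h.mono deleteEdges_le))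
  have hN' : K.nbrs y = {c, d} := by
    ext w
    rw [mem_nbrs, hadj, deleteEdges_adj_iff hs hl, hNy]
    grind
  obtain ⟨g, H, hHs, hVH, hEH, hsub', hg, hlink, hadj'⟩ := hKs.exists_isSubdividing hN' hcd (by
    rw [hadj]
    rintro (h | h)
    · exact hnadj' (h.1.mono deleteEdges_le)
    · exact hne h)
  have hVH' : V(H) = (V(G) \ {x}) \ {y} := by rw [hVH, hVK]; simp
  have hfH : H.IsLink f a b := hlink f a b hf hay hby
  have hfg : g ≠ f := by
    rintro rfl
    have := hg.eq_and_eq_or_eq_and_eq hfH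
    exact hne this
  have h4 : 3 < V(H).encard := by
    have hmem : ∀ z ∈ V(G), z ≠ x → z ≠ y → z ∈ V(H) := fun z hz h1 h2 => by
      rw [hVH']
      exact ⟨⟨hz, h1⟩, h2⟩
    have hac : ∃ z ∈ V(H), z ≠ a ∧ z ≠ b ∧ G.Adj a z := by
      obtain ⟨z, hz, -, hzx, hzy⟩ := hG.exists_adj_ne hxa.right_mem x y
      refine ⟨z, hmem z hz.right_mem hzx hzy, hz.ne.symm, ?_, hz⟩
      rintro rfl
      exact hnadj hz
    have hbc : ∃ z ∈ V(H), z ≠ b ∧ z ≠ a ∧ G.Adj b z := by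
      obtain ⟨z, hz, -, hzx, hzy⟩ := hG.exists_adj_ne hxb.right_mem x y
      refine ⟨z, hmem z hz.right_mem hzx hzy, hz.ne.symm, ?_, hz⟩
      rintro rfl
      exact hnadj hz.symm
    obtain ⟨z, hz, hza, hzb, haz⟩ := hac
    obtain ⟨t, ht, htb, hta, hbt⟩ := hbc
    have haH : a ∈ V(H) := hmem a hxa.right_mem hxa'.symm hay
    have hbH : b ∈ V(H) := hmem b hxb.right_mem hxb'.symm hby
    have hcH : c ∈ V(H) := hmem c hyc.right_mem hcx hyc'.symm
    have hdH : d ∈ V(H) := hmem d hyd.right_mem hdx hyd'.symm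
    -- If only `a`, `b`, `z` remained, then `z` would be adjacent to both `a` and `b`, and one of
    -- `c`, `d` would be `z` while the other is `a` or `b`, although `c` and `d` are nonadjacent.
    have h4 : ∃ r ∈ V(H), r ≠ a ∧ r ≠ b ∧ r ≠ z := by
      by_contra! hcon
      have h1 := hcon c hcH
      have h2 := hcon d hdH
      have h3 := hcon t ht
      obtain rfl := h3 hta htb
      have h6 : ∀ w, w = a ∨ w = b → G.Adj t w := by
        rintro w (rfl | rfl)
        · exact haz.symm
        · exact hbt.symm
      by_cases hc : c = a ∨ c = b
      · by_cases hd : d = a ∨ d = b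
        · rcases hc with rfl | rfl <;> rcases hd with rfl | rfl
          · exact hcd rfl
          · exact hne (Or.inl ⟨rfl, rfl⟩)
          · exact hne (Or.inr ⟨rfl, rfl⟩)
          · exact hcd rfl
        · rw [not_or] at hd
          exact hnadj' (h2 hd.1 hd.2 ▸ h6 c hc).symm
      · rw [not_or] at hc
        have hct := h1 hc.1 hc.2
        by_cases hd : d = a ∨ d = b
        · exact hnadj' (hct ▸ h6 d hd)
        · rw [not_or] at hd
          exact hcd (hct.trans (h2 hd.1 hd.2).symm)
    obtain ⟨r, hr, hra, hrb, hrz⟩ := h4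
    have hsub : ({a, b, z, r} : Set α) ⊆ V(H) := by grind
    refine lt_of_lt_of_le ?_ (Set.encard_le_encard hsub)
    rw [Set.encard_insert_of_notMem (by grind), Set.encard_insert_of_notMem (by grind),
      Set.encard_pair (by grind)]
    norm_num
  have h3 : H.IsKConnected 3 := by
    refine hfat.isKConnected hG hs.toLoopless h4 (by rw [hVH']; grind) (fun w hw => ?_) ?_ ?_ ?_
      ?_ ?_
    · rw [hVH']
      grind
    · intro c hc d hd hcd h1 h2
      rw [hVH'] at hc hd
      rw [hadj', hadj, deleteEdges_adj_iff hs hl]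
      exact Or.inl ⟨Or.inl ⟨⟨hcd, h1, h2⟩, hc.1.2, hd.1.2⟩, hc.2, hd.2⟩
    · intro _
      exact ⟨a, b, hfH.adj, fun z hz => (hNx z).1 hz⟩
    · intro _
      exact ⟨c, d, hg.adj, fun z hz => (hNy z).1 hz⟩
    · intro h
      rw [hVH'] at h
      exact absurd rfl h.1.2
    · intro h
      rw [hVH'] at h
      exact absurd rfl h.2
  refine ⟨H, hHs, ssubset_of_subset_deleteEdges hl (hEH.trans hEK), by rw [hVH']; grind, ?_⟩
  have := IsBGOp.subdivideTwo (g := e) g f y x _ _ h3 hg.edge_mem hfH.edge_mem hfg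
    (by rintro ⟨p, q, h1, h2⟩; exact hfg (h1.eq h2)) hsub' hsub notMem_edgeSet_deleteEdges
  rwa [addEdge_comm, addEdge_deleteEdges hl] at this

/-- A simple 3-connected graph with at least five vertices arises by an operation of Barnette
and Grünbaum from a simple 3-connected graph. -/
theorem IsKConnected.exists_isBGOp (hG : G.IsKConnected 3) (hs : G.Simple) (hf : V(G).Finite)
    (h5 : 5 ≤ V(G).encard) : ∃ (e : β) (H : Graph α β), H.Simple ∧ E(H) ⊂ E(G) ∧ V(H) ⊆ V(G) ∧
      H.IsBGOp e G := by
  obtain ⟨x, y, ⟨e, hl⟩, hfat, hx, hy⟩ := hG.exists_noFatSep hs hf h5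
  refine ⟨e, ?_⟩
  rcases hG.nbrs_cases hl.adj with ⟨a, b, hab, hay, hby, hNx⟩ | hNx
  · have hnab : ¬ G.Adj a b := fun h => hx a b hab hay hby h hNx
    rcases hG.nbrs_cases hl.symm.adj with ⟨c, d, hcd, hcx, hdx, hNy⟩ | hNy
    · exact hfat.isBGOp_subdivideTwo hG hs hl h5 hab hay hby hNx hnab hcd hcx hdx hNy
        (fun h => hy c d hcd hcx hdx h hNy)
    · exact hfat.isBGOp_subdivideOne hG hs hl h5 hab hay hby hNx hnab hNy
  · rcases hG.nbrs_cases hl.symm.adj with ⟨c, d, hcd, hcx, hdx, hNy⟩ | hNy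
    · exact hfat.symm.isBGOp_subdivideOne hG hs hl.symm h5 hcd hcx hdx hNy
        (fun h => hy c d hcd hcx hdx h hNy) hNx
    · exact hfat.isBGOp_add hG hs hl hNx hNy

end Existence

end Graph

/-! ### Construction sequences and the main theorem. -/

namespace Graph

variable {α β : Type*} {e : β} {G H K : Graph α β}

/-- An edge of a simple graph is determined by its ends. Finiteness makes the number of edges a
valid induction measure. -/
lemma Simple.finite_edgeSet (hs : G.Simple) (hf : V(G).Finite) : E(G).Finite := by
  have h1 : (V(G) ×ˢ V(G)).Finite := hf.prod hf
  have h2 : ∀ e ∈ E(G), ∃ p : α × α, G.IsLink e p.1 p.2 := by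
    intro e he
    obtain ⟨a, b, h⟩ := mem_edgeSet_iff.1 he
    exact ⟨(a, b), h⟩
  rcases E(G).eq_empty_or_nonempty with h0 | ⟨e₀, he₀⟩
  · simp [h0]
  obtain ⟨p₀, -⟩ := h2 e₀ he₀
  have : Nonempty (α × α) := ⟨p₀⟩
  choose! p hp using h2
  refine Set.Finite.of_finite_image (f := p) (h1.subset ?_) ?_
  · rintro _ ⟨e, he, rfl⟩
    exact ⟨(hp e he).left_mem, (hp e he).right_mem⟩
  · intro e he f hf hef
    have := hp f hf
    rw [← hef] at this
    exact (hp e he).eq this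

lemma IsK4.isKConnected (hK : K.IsK4) : K.IsKConnected 3 := by
  refine isKConnected_three_of_crossing (by rw [hK.2.1]; norm_num) ?_
  intro Q p q s t hp hq hpq hs ht hsQ hsp hsq htQ htp htq
  exact ⟨s, t, hK.2.2 s hs t ht (by rintro rfl; exact htQ hsQ), hsQ, hsp, hsq, htQ, htp, htq⟩

lemma IsKConnected.isK4 (hG : G.IsKConnected 3) (hs : G.Simple) (h4 : V(G).encard = 4) :
    G.IsK4 :=
  ⟨hs, h4, fun _ hx _ hy hxy => adj_of_encard_eq_four hG h4 hx hy hxy⟩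

lemma Simple.isBasicBGOp (hs : H.Simple) (h : G.IsBGOp e H) : G.IsBasicBGOp e H :=
  ⟨h, fun _ _ _ _ hef h1 h2 => absurd (h1.eq h2) hef⟩

/-- Every simple 3-connected graph has a basic construction sequence from `K₄`. -/
theorem IsKConnected.exists_reflTransGen (hG : G.IsKConnected 3) (hs : G.Simple)
    (hf : V(G).Finite) : ∃ K : Graph α β, K.IsK4 ∧
      Relation.ReflTransGen (fun H H' => ∃ e, H.IsBasicBGOp e H') K G := by
  induction hn : E(G).ncard using Nat.strong_induction_on generalizing G with
  | _ n ih =>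
    by_cases h4 : V(G).encard = 4
    · exact ⟨G, hG.isK4 hs h4, .refl⟩
    · have h4' : 4 ≤ V(G).encard := by
        have := Order.add_one_le_of_lt hG.1
        norm_num at this
        exact this
      have h5 : 5 ≤ V(G).encard := by
        have := Order.add_one_le_of_lt (lt_of_le_of_ne h4' (Ne.symm h4))
        norm_num at this
        exact this
      obtain ⟨e, H, hHs, hE, hV, hH⟩ := hG.exists_isBGOp hs hf h5
      obtain ⟨K, hK, hKH⟩ := ih _ (hn ▸ Set.ncard_lt_ncard hE (hs.finite_edgeSet hf))
        hH.isKConnected_left hHs (hf.subset hV) rfl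
      exact ⟨K, hK, hKH.tail ⟨e, hs.isBasicBGOp hH⟩⟩

/-- Looplessness is carried along the sequence, since intermediate graphs are not assumed simple and
inverting each step needs it. -/
theorem reflTransGen_isGoodRemoval (hK : K.Loopless)
    (h : Relation.ReflTransGen (fun H H' => ∃ e, H.IsBasicBGOp e H') K G) :
    G.Loopless ∧ Relation.ReflTransGen (fun H' H => ∃ e, H'.IsGoodRemoval e H) G K := by
  induction h with
  | refl => exact ⟨hK, .refl⟩
  | tail _ h ih =>
    obtain ⟨e, he⟩ := h
    exact ⟨he.1.loopless ih.1, ih.2.head ⟨e, he.isGoodRemoval ih.1⟩⟩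

theorem reflTransGen_isBGOp (hG : G.Loopless)
    (h : Relation.ReflTransGen (fun H' H => ∃ e, H'.IsGoodRemoval e H) G K) :
    K.Loopless ∧ Relation.ReflTransGen (fun H H' => ∃ e, H.IsBGOp e H') K G := by
  induction h with
  | refl => exact ⟨hG, .refl⟩
  | tail _ h ih =>
    obtain ⟨e, he⟩ := h
    exact ⟨he.loopless ih.1, ih.2.head ⟨e, he.isBGOp ih.1⟩⟩

theorem IsKConnected.of_reflTransGen (hK : K.Loopless) (h3 : K.IsKConnected 3)
    (h : Relation.ReflTransGen (fun H H' => ∃ e, H.IsBGOp e H') K G) :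
    G.Loopless ∧ G.IsKConnected 3 := by
  induction h with
  | refl => exact ⟨hK, h3⟩
  | tail _ h ih =>
    obtain ⟨e, he⟩ := h
    exact ⟨he.loopless ih.1, he.isKConnected ih.1⟩

end Graph

theorem mainTheorem1 {α β : Type*} :
    (∀ G : Graph α β, V(G).Finite → G.Simple →
      List.TFAE [
        G.IsKConnected 3,
        ∃ K : Graph α β, K.IsK4 ∧
          Relation.ReflTransGen (fun H' H => ∃ e, H'.IsGoodRemoval e H) G K,
        ∃ K : Graph α β, K.IsK4 ∧
          Relation.ReflTransGen (fun H H' => ∃ e, H.IsBGOp e H') K G,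
        ∃ K : Graph α β, K.IsK4 ∧
          Relation.ReflTransGen (fun H H' => ∃ e, H.IsBasicBGOp e H') K G]) ∧
    (∀ (H H' : Graph α β) (e : β), H.Loopless → H'.Loopless →
      V(H').Finite → E(H').Finite →
      (H'.IsGoodRemoval e H ↔ H.IsBGOp e H' ∧ 5 ≤ V(H').encard) ∧
      (H.IsBasicBGOp e H' → H'.IsGoodRemoval e H)) := by
  refine ⟨fun G hf hs => ?_, fun H H' e hH hH' _ _ => ⟨Graph.isGoodRemoval_iff hH hH', fun h =>
    h.isGoodRemoval hH⟩⟩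
  tfae_have 1 → 4 := fun hG => hG.exists_reflTransGen hs hf
  tfae_have 4 → 2 := fun ⟨K, hK, h⟩ => ⟨K, hK, (Graph.reflTransGen_isGoodRemoval hK.1.toLoopless h).2⟩
  tfae_have 2 → 3 := fun ⟨K, hK, h⟩ => ⟨K, hK, (Graph.reflTransGen_isBGOp hs.toLoopless h).2⟩
  tfae_have 3 → 1 := fun ⟨K, hK, h⟩ =>
    (Graph.IsKConnected.of_reflTransGen hK.1.toLoopless hK.isKConnected h).2
  tfae_finish
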